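/- Let $n\ge 0$ and let $V(n)=(\mathbb{C}[t]/t^n)^2$. Every $a\in V(n)$ is uniquely $\sum_{i=0}^{n-1}a_it^i$ with $a_i\in\mathbb{C}^2$; give $V(n)$ the Hermitian inner product $\langle\sum a_it^i,\sum b_it^i\rangle=\sum_i\langle a_i,b_i\rangle$, and let $\omega\colon V(n)\to\mathbb{C}^2$ be the linear map $\omega(\sum a_it^i)=\sum a_i$. Let $X(n)$ be the space of complete flags $0=W_0<W_1<\dots<W_{2n}=V(n)$ of $\mathbb{C}[t]$-submodules of $V(n)$, with the topology inherited from the product of the Grassmannians of $V(n)$. Let $\chi\colon\mathbb{CP}^1\to\mathbb{CP}^1$ be the antipodal map $\chi(L)=L^\perp$. Then for each $\underline{W}\in X(n)$ and $1\le i\le 2n$ the space $\overline{\omega}_i(\underline{W})=\omega(W_i\cap W_{i-1}^\perp)$ is a line in $\mathbb{C}^2$, and the resulting maps $\overline{\omega}_i\colon X(n)\to\mathbb{CP}^1$ have the following properties. (1) A subset $K\subseteq\{1,\dots,2n\}$ is sparse if for each $k\in K$ the set $\{k+1,\dots,2n\}$ has more elements outside $K$ than in $K$. A non-crossing matching is a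 permutation $\tau$ of $\{1,\dots,2n\}$ with $\tau^2=1$, $\tau(i)\ne i$ for all $i$, and no $i<j<\tau(i)<\tau(j)$; sparse sets $K$ of size $n$ correspond bijectively to non-crossing matchings $\tau$ by $K=\{i\mid i<\tau(i)\}$. For such $K$ and $\tau$ let $X'(n,K)=\{u\colon\{1,\dots,2n\}\to\mathbb{CP}^1\mid u(\tau(i))=\chi(u(i))\text{ for all }i\}$, and let $X'(n)=\bigcup_KX'(n,K)\subseteq(\mathbb{CP}^1)^{2n}$, where $K$ runs over the sparse sets of size $n$. Then $\underline{W}\mapsto(\overline{\omega}_i(\underline{W}))_i$ is a homeomorphism $X(n)\to X'(n)$. (2) Let $n>0$ and let $C(n)$ be the $2n$-gon: the graph with vertex set $\mathbb{Z}/2n$ and directed edges $e_i=(i-1,i)$ and $\overline{e}_i=(i,i-1)$, with the parity map $\mathbb{Z}/2n\to\mathbb{Z}/2$ on vertices. For a graph $G$ let $Y_1(G)$ be the space of maps $m$ from the set of directed edges of $G$ to $\mathbb{CP}^1$ with $m(\overline{e})=\chi(m(e))$ for every edge $e$, where $\overline{e}$ is the reversed edge. A tree folding $p\colon C(n)\to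 T$ is the quotient map to $T=C(n)/{\sim}$ (with edges the images of edges) for an equivalence relation $\sim$ on vertices such that equivalent vertices have the same parity and $T$ is a tree. Let $Y(C(n))\subseteq Y_1(C(n))$ be the union of the subspaces $p^*(Y_1(T))$ over all tree foldings $p\colon C(n)\to T$. Then there is a homeomorphism $\sigma\colon X(n)\to Y(C(n))$ given by $\sigma(\underline{W})(e_i)=\overline{\omega}_i(\underline{W})$ and $\sigma(\underline{W})(\overline{e}_i)=\chi(\overline{\omega}_i(\underline{W}))$. -/

import Mathlib

open Polynomial

open scoped LinearAlgebra.Projectivization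

noncomputable section

namespace KhovanovSpringer

/-! ### The projective line and the antipodal map -/

/-- `ℂ²` with its usual Hermitian inner product. -/
abbrev C2 : Type := EuclideanSpace ℂ (Fin 2)

/-- The complex projective line: lines through the origin in `ℂ²`. -/
abbrev CP1 : Type := ℙ ℂ C2

/-- `ℂP¹` carries the quotient topology from `ℂ² ∖ {0}`. -/
instance : TopologicalSpace CP1 :=
  inferInstanceAs (TopologicalSpace (Quotient (projectivizationSetoid ℂ C2)))

theorem finrank_orthogonal_line (L : CP1) : Module.finrank ℂ (L.submodule)ᗮ = 1 := by
  have h := L.submodule.finrank_add_finrank_orthogonal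
  rw [L.finrank_submodule, finrank_euclideanSpace_fin] at h
  omega

/-- The antipodal map `χ(L) = Lᗮ` on `ℂP¹`. -/
def chi (L : CP1) : CP1 :=
  Projectivization.mk'' (L.submodule)ᗮ (finrank_orthogonal_line L)

/-! ### The module `V(n) = (ℂ[t]/tⁿ)²`, its inner product and the map `ω` -/

/-- `V(n) = (ℂ[t]/tⁿ)²`. -/
def V (n : ℕ) : Type := Fin 2 → (ℂ[X] ⧸ Ideal.span {(X : ℂ[X]) ^ n})

instance (n : ℕ) : AddCommGroup (V n) :=
  inferInstanceAs (AddCommGroup (Fin 2 → (ℂ[X] ⧸ Ideal.span {(X : ℂ[X]) ^ n})))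

instance (n : ℕ) : Module ℂ[X] (V n) :=
  inferInstanceAs (Module ℂ[X] (Fin 2 → (ℂ[X] ⧸ Ideal.span {(X : ℂ[X]) ^ n})))

instance (n : ℕ) : Module ℂ (V n) :=
  inferInstanceAs (Module ℂ (Fin 2 → (ℂ[X] ⧸ Ideal.span {(X : ℂ[X]) ^ n})))

instance (n : ℕ) : IsScalarTower ℂ ℂ[X] (V n) :=
  inferInstanceAs (IsScalarTower ℂ ℂ[X] (Fin 2 → (ℂ[X] ⧸ Ideal.span {(X : ℂ[X]) ^ n})))

/-- The unique polynomial of degree `< n` representing a class in `ℂ[t]/tⁿ`. -/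
def reduced (n : ℕ) : (ℂ[X] ⧸ Ideal.span {(X : ℂ[X]) ^ n}) →ₗ[ℂ] ℂ[X] :=
  AdjoinRoot.modByMonicHom (monic_X_pow n)

theorem reduced_mk (n : ℕ) (f : ℂ[X]) :
    reduced n (Ideal.Quotient.mk _ f) = f %ₘ (X ^ n) :=
  AdjoinRoot.modByMonicHom_mk (monic_X_pow n) f

theorem mk_reduced (n : ℕ) (a : ℂ[X] ⧸ Ideal.span {(X : ℂ[X]) ^ n}) :
    Ideal.Quotient.mk _ (reduced n a) = a :=
  AdjoinRoot.mk_leftInverse (monic_X_pow n) a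

theorem degree_reduced_lt (n : ℕ) (a : ℂ[X] ⧸ Ideal.span {(X : ℂ[X]) ^ n}) :
    (reduced n a).degree < n := by
  obtain ⟨f, rfl⟩ := Ideal.Quotient.mk_surjective a
  rw [reduced_mk]
  simpa using degree_modByMonic_lt f (monic_X_pow (R := ℂ) n)

/-- The coefficient `aᵢ ∈ ℂ²` of `a = ∑ aᵢ tⁱ ∈ V(n)`. -/
def coeffVec {n : ℕ} (i : Fin n) (a : V n) : C2 :=
  WithLp.toLp 2 fun j => (reduced n (a j)).coeff i

theorem coeffVec_add {n : ℕ} (i : Fin n) (a b : V n) :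
    coeffVec i (a + b) = coeffVec i a + coeffVec i b := by
  ext j
  change (reduced n (a j + b j)).coeff i = _
  rw [map_add, coeff_add]
  rfl

theorem coeffVec_smul {n : ℕ} (i : Fin n) (c : ℂ) (a : V n) :
    coeffVec i (c • a) = c • coeffVec i a := by
  ext j
  change (reduced n (c • a j)).coeff i = _
  rw [map_smul, coeff_smul]
  rfl

theorem eq_zero_of_coeffVec {n : ℕ} (a : V n) (h : ∀ i : Fin n, coeffVec i a = 0) : a = 0 := by
  funext j
  have h0 : reduced n (a j) = 0 := by
    ext k
    by_cases hk : k < n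
    · exact congrArg (fun v : C2 => v j) (h ⟨k, hk⟩)
    · rw [coeff_zero]
      refine coeff_eq_zero_of_degree_lt (lt_of_lt_of_le (degree_reduced_lt n (a j)) ?_)
      exact_mod_cast not_lt.mp hk
  rw [← mk_reduced n (a j), h0, map_zero]
  rfl

/-- The Hermitian inner product `⟨∑ aᵢ tⁱ, ∑ bᵢ tⁱ⟩ = ∑ ⟨aᵢ, bᵢ⟩` on `V(n)` (conjugate-linear in the
first variable, as everywhere in Mathlib). -/
@[reducible] def innerCore (n : ℕ) : InnerProductSpace.Core ℂ (V n) where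
  inner a b := ∑ i : Fin n, inner ℂ (coeffVec i a) (coeffVec i b)
  conj_inner_symm a b := by simp [map_sum]
  re_inner_nonneg a := by
    rw [map_sum]
    exact Finset.sum_nonneg fun i _ => inner_self_nonneg
  add_left a b c := by simp [coeffVec_add, Finset.sum_add_distrib]
  smul_left a b c := by simp [coeffVec_smul, Finset.mul_sum, mul_comm]
  definite a h := by
    apply eq_zero_of_coeffVec
    have h' : ∑ i : Fin n, (‖coeffVec i a‖ ^ 2 : ℝ) = 0 := by
      have := congrArg Complex.re h
      simpa [inner_self_eq_norm_sq_to_K, ← Complex.ofReal_pow] using this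
    intro i
    have := (Finset.sum_eq_zero_iff_of_nonneg fun i _ => sq_nonneg _).mp h' i (Finset.mem_univ i)
    simpa using this

instance (n : ℕ) : NormedAddCommGroup (V n) := (innerCore n).toNormedAddCommGroup

instance (n : ℕ) : InnerProductSpace ℂ (V n) := InnerProductSpace.ofCore (innerCore n).toCore

instance (n : ℕ) : FiniteDimensional ℂ (V n) := by
  have : Module.Finite ℂ (ℂ[X] ⧸ Ideal.span {(X : ℂ[X]) ^ n}) :=
    (AdjoinRoot.powerBasis' (monic_X_pow (R := ℂ) n)).finite
  exact inferInstanceAs (Module.Finite ℂ (Fin 2 → (ℂ[X] ⧸ Ideal.span {(X : ℂ[X]) ^ n})))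

/-- The linear map `ω(∑ aᵢ tⁱ) = ∑ aᵢ` from `V(n)` to `ℂ²`. -/
def omega (n : ℕ) : V n →ₗ[ℂ] C2 where
  toFun a := ∑ i : Fin n, coeffVec i a
  map_add' a b := by simp [coeffVec_add, Finset.sum_add_distrib]
  map_smul' c a := by simp [coeffVec_smul, Finset.smul_sum]

/-! ### The Khovanov–Springer variety `X(n)` -/

/-- `X(n)`: the complete flags `0 = W₀ < W₁ < ⋯ < W₂ₙ = V(n)` of `ℂ[t]`-submodules of `V(n)`. -/
def FlagVariety (n : ℕ) : Type :=
  {W : Fin (2 * n + 1) → Submodule ℂ[X] (V n) //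
    W 0 = ⊥ ∧ W (Fin.last (2 * n)) = ⊤ ∧ ∀ i : Fin (2 * n), W i.castSucc < W i.succ}

/-- The `i`-th term of a flag, as a complex subspace of `V(n)`. -/
def FlagVariety.subspace {n : ℕ} (W : FlagVariety n) (i : Fin (2 * n + 1)) : Submodule ℂ (V n) :=
  (W.1 i).restrictScalars ℂ

/-- The usual (classical) topology on `X(n)`, as a subspace of a product of Grassmannians, where
Grassmannians are topologised by identifying a subspace with the orthogonal projection onto it. -/
instance (n : ℕ) : TopologicalSpace (FlagVariety n) :=
  TopologicalSpace.induced
    (fun W => fun i : Fin (2 * n + 1) => ((W.subspace i).starProjection : V n →L[ℂ] V n))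
    inferInstance

/-- The subspace `ω(Wᵢ ⊖ Wᵢ₋₁)` of `ℂ²`. The index `i : Fin (2 * n)` stands for `i + 1` in
`{1, …, 2n}`. -/
def omegaLine {n : ℕ} (W : FlagVariety n) (i : Fin (2 * n)) : Submodule ℂ C2 :=
  (W.subspace i.succ ⊓ (W.subspace i.castSucc)ᗮ).map (omega n)

/-! ### Sparse sets, non-crossing matchings and the spaces `X'(n,K)` -/

/-- `J` is sparse if for each `j ∈ J` more elements above `j` lie outside `J` than in `J`. -/
def IsSparse {m : ℕ} (J : Finset (Fin m)) : Prop :=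
  ∀ j ∈ J, (J.filter (j < ·)).card < (Jᶜ.filter (j < ·)).card

/-- Non-crossing matchings: fixed-point-free involutions without `i < j < τ i < τ j`. -/
def IsNonCrossingMatching {m : ℕ} (τ : Equiv.Perm (Fin m)) : Prop :=
  (∀ i, τ (τ i) = i) ∧ (∀ i, τ i ≠ i) ∧ ¬ ∃ i j, i < j ∧ j < τ i ∧ τ i < τ j

/-- The space `X'(n,K)` of maps `u : {1, …, 2n} → ℂP¹` with `u (τ i) = χ (u i)`, where `τ` is the
non-crossing matching corresponding to `K`, i.e. the one with `K = {i | i < τ i}`. -/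
def XPrimeOf (n : ℕ) (K : Finset (Fin (2 * n))) : Set (Fin (2 * n) → CP1) :=
  {u | ∃ τ : Equiv.Perm (Fin (2 * n)), IsNonCrossingMatching τ ∧ (∀ i, i ∈ K ↔ i < τ i) ∧
    ∀ i, u (τ i) = chi (u i)}

/-- `X'(n)`: the union of the `X'(n,K)` over all sparse sets `K` of size `n`. -/
def XPrime (n : ℕ) : Set (Fin (2 * n) → CP1) :=
  ⋃ K ∈ {K : Finset (Fin (2 * n)) | IsSparse K ∧ K.card = n}, XPrimeOf n K

/-! ### Graphs, tree foldings and the space `Y(G)` -/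

/-- A connected graph on the vertex set `A` together with a parity map, i.e. a morphism to the
complete graph on two vertices. Directed edges are the darts `graph.Dart`, and edge reversal is
`SimpleGraph.Dart.symm`. -/
structure ParityGraph (A : Type*) where
  graph : SimpleGraph A
  connected : graph.Connected
  parity : graph.Coloring (ZMod 2)

/-- `Y₁(G)`: the `ℂP¹`-labellings `m` of directed edges such that reversing an edge changes its
label by `χ`. -/
def Y1 {A : Type*} (G : SimpleGraph A) : Set (G.Dart → CP1) :=
  {m | ∀ e, m e.symm = chi (m e)}

/-- An equivalence relation on the vertices is foldable if equivalent vertices have equal parity. -/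
def ParityGraph.Foldable {A : Type*} (G : ParityGraph A) (s : Setoid A) : Prop :=
  ∀ u v, s u v → G.parity u = G.parity v

/-- The quotient graph of `G` by an equivalence relation: the edges are the images of edges. -/
def ParityGraph.quotient {A : Type*} (G : ParityGraph A) (s : Setoid A) :
    SimpleGraph (Quotient s) :=
  G.graph.map (Quotient.mk s)

/-- The folding `G → G/∼` of a foldable equivalence relation. -/
def ParityGraph.folding {A : Type*} (G : ParityGraph A) (s : Setoid A) (hs : G.Foldable s) :
    G.graph →g G.quotient s :=
  SimpleGraph.Hom.map (Quotient.mk s) G.graph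
    fun {u v} h huv => G.parity.valid h (hs u v (Quotient.exact huv))

/-- `Y(G)`: the union, over all tree foldings `p : G → T`, of the subspaces `p^*(Y₁(T))` of
`Y₁(G)`. -/
def Y {A : Type*} (G : ParityGraph A) : Set (G.graph.Dart → CP1) :=
  {m | ∃ (s : Setoid A) (hs : G.Foldable s), (G.quotient s).IsTree ∧
    ∃ m' ∈ Y1 (G.quotient s), m = fun e => m' ((G.folding s hs).mapDart e)}

/-! ### The `2n`-gon -/

/-- The parity `ℤ/2n → ℤ/2`. -/
def polygonParity (n : ℕ) : ZMod (2 * n) →+* ZMod 2 :=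
  ZMod.castHom (dvd_mul_right 2 n) (ZMod 2)

theorem polygonParity_succ_ne (n : ℕ) (i : ZMod (2 * n)) :
    polygonParity n (i + 1) ≠ polygonParity n i := by
  rw [map_add, map_one]
  simp

/-- The underlying graph of the `2n`-gon: vertices `ℤ/2n`, edges `(i, i + 1)` and `(i + 1, i)`. -/
def polygonGraph (n : ℕ) : SimpleGraph (ZMod (2 * n)) where
  Adj i j := j = i + 1 ∨ i = j + 1
  symm := ⟨fun _ _ h => h.symm⟩
  loopless := ⟨fun i h =>
    polygonParity_succ_ne n i (congrArg (polygonParity n) (h.elim Eq.symm Eq.symm))⟩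

theorem polygonGraph_connected (n : ℕ) : (polygonGraph n).Connected := by
  have key : ∀ k : ℤ, (polygonGraph n).Reachable 0 (k : ZMod (2 * n)) := by
    intro k
    induction k using Int.induction_on with
    | zero => simp
    | succ k ih =>
      refine ih.trans (SimpleGraph.Adj.reachable (Or.inl ?_))
      push_cast
      ring
    | pred k ih =>
      refine ih.trans (SimpleGraph.Adj.reachable (Or.inr ?_))
      push_cast
      ring
  have : Nonempty (ZMod (2 * n)) := ⟨0⟩
  refine SimpleGraph.Connected.mk fun u v => ?_
  obtain ⟨a, rfl⟩ := ZMod.intCast_surjective u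
  obtain ⟨b, rfl⟩ := ZMod.intCast_surjective v
  exact (key a).symm.trans (key b)

/-- The `2n`-gon `C(n)`, for `n > 0`. -/
def polygon (n : ℕ) : ParityGraph (ZMod (2 * n)) where
  graph := polygonGraph n
  connected := polygonGraph_connected n
  parity := SimpleGraph.Coloring.mk (polygonParity n) fun {u v} h => by
    rcases h with rfl | rfl
    · exact (polygonParity_succ_ne n u).symm
    · exact polygonParity_succ_ne n v

/-- The directed edge `eᵢ = (i - 1, i)` of `C(n)`. The index `i : Fin (2 * n)` stands for `i + 1` in
`{1, …, 2n}`. -/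
def polygonEdge (n : ℕ) (i : Fin (2 * n)) : (polygon n).graph.Dart :=
  ⟨((i : ℕ), (i : ℕ) + 1), Or.inl rfl⟩

end KhovanovSpringer

end

/-!
Listing coefficients in descending degree embeds all the spaces `V(n)` isometrically in one space
of finitely supported sequences, in which multiplication by `t` is the backward shift and `V(n)` is
the kernel of `tⁿ`. A flag is built up from `0` one dimension at a time: above a stable subspace
`W`, the next term lies between `W` and `t⁻¹W`, and it is determined by a line in the orthogonal
complement of `W` in `t⁻¹W`. On this complement `ω` is an isometry onto `ℂ²`, since multiplication
by `1 - t` telescopes sums, so flags correspond to the words of `2n` lines in `ℂ²` whose last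
subspace is `V(n)`.

Two successive orthogonal lines extend `W` to the whole of `t⁻¹W`, so deleting such a pair from a
word amounts to applying `t` to the subspaces after it. The first term of a flag that contains
`ker t` is reached by such a pair, hence the words of flags are those that can be reduced to the
empty word, that is, those compatible with a non-crossing matching. They are also the labels read
off on a walk round a labelled plane tree, the quotient of the polygon in which two vertices are
identified if the same arcs of the matching pass over them.

The line attached to the `i`-th step of a flag has the orthogonal projection
`ω (Pᵢ - Pᵢ₋₁) ω†`, where `Pᵢ` is the projection onto the `i`-th term. Hence the bijection is
continuous, and it goes from a compact space to a Hausdorff space.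
-/

noncomputable section

namespace KhovanovSpringer

/-! ### Finitely supported sequences -/

/-- Finitely supported sequences in `E`, that is, the union of all the spaces of truncated
polynomials with coefficients in `E`, glued along multiplication by `t`. The field only
determines the inner product. -/
def Tail (_𝕜 E : Type*) [Zero E] : Type _ := ℕ →₀ E

namespace Tail

variable {𝕜 E : Type*} [RCLike 𝕜] [NormedAddCommGroup E] [InnerProductSpace 𝕜 E]

instance : AddCommGroup (Tail 𝕜 E) := inferInstanceAs (AddCommGroup (ℕ →₀ E))

instance : Module 𝕜 (Tail 𝕜 E) := inferInstanceAs (Module 𝕜 (ℕ →₀ E))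

/-- The `i`-th entry of a finitely supported sequence. -/
def coord (i : ℕ) : Tail 𝕜 E →ₗ[𝕜] E := Finsupp.lapply i

theorem ext_coord {a b : Tail 𝕜 E} (h : ∀ i, coord i a = coord i b) : a = b := Finsupp.ext h

theorem hasFiniteSupport_coord (a : Tail 𝕜 E) : Function.HasFiniteSupport fun i => coord i a :=
  Finsupp.hasFiniteSupport a

theorem exists_coord_eq_zero (a : Tail 𝕜 E) : ∃ N, ∀ i, N ≤ i → coord i a = 0 := by
  obtain ⟨N, hN⟩ := (hasFiniteSupport_coord a).bddAbove
  refine ⟨N + 1, fun i hi => ?_⟩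
  by_contra h
  exact absurd (hN h) (by omega)

theorem summable_coord (a : Tail 𝕜 E) : Summable fun i => coord i a :=
  summable_of_hasFiniteSupport (hasFiniteSupport_coord a)

theorem summable_inner_coord (a b : Tail 𝕜 E) :
    Summable fun i => inner 𝕜 (coord i a) (coord i b) :=
  summable_of_hasFiniteSupport <| (hasFiniteSupport_coord a).subset fun i hi ha =>
    hi (by simp only [ha, inner_zero_left])

/-- The inner product `⟪a, b⟫ = ∑ᵢ ⟪aᵢ, bᵢ⟫` on finitely supported sequences. -/
@[reducible] def innerCore (𝕜 E : Type*) [RCLike 𝕜] [NormedAddCommGroup E]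
    [InnerProductSpace 𝕜 E] : InnerProductSpace.Core 𝕜 (Tail 𝕜 E) where
  inner a b := ∑' i, inner 𝕜 (coord i a) (coord i b)
  conj_inner_symm a b := by simp only [RCLike.conj_tsum, inner_conj_symm]
  re_inner_nonneg a := by
    rw [← RCLike.reCLM_apply, RCLike.reCLM.map_tsum (summable_inner_coord a a)]
    exact tsum_nonneg fun i => inner_self_nonneg
  add_left a b c := by
    simp only [map_add, inner_add_left]
    exact (summable_inner_coord a c).tsum_add (summable_inner_coord b c)
  smul_left a b c := by simp only [map_smul, inner_smul_left, tsum_mul_left]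
  definite a h := by
    have hre : HasSum (fun i => RCLike.re (inner 𝕜 (coord i a) (coord i a))) 0 := by
      simpa only [h, RCLike.reCLM_apply, map_zero] using
        RCLike.reCLM.hasSum (summable_inner_coord a a).hasSum
    refine ext_coord fun i => ?_
    rw [map_zero]
    exact re_inner_self_nonpos.mp
      (congrFun ((hasSum_zero_iff_of_nonneg fun i => inner_self_nonneg).mp hre) i).le

instance : NormedAddCommGroup (Tail 𝕜 E) := (innerCore 𝕜 E).toNormedAddCommGroup

instance : InnerProductSpace 𝕜 (Tail 𝕜 E) := InnerProductSpace.ofCore (innerCore 𝕜 E).toCore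

theorem inner_eq_tsum (a b : Tail 𝕜 E) :
    inner 𝕜 a b = ∑' i, inner 𝕜 (coord i a) (coord i b) := rfl

/-- The sum of the entries of a finitely supported sequence; it extends the map `ω`. -/
def total : Tail 𝕜 E →ₗ[𝕜] E where
  toFun a := ∑' i, coord i a
  map_add' a b := by
    simp only [map_add]
    exact (summable_coord a).tsum_add (summable_coord b)
  map_smul' c a := by simp only [map_smul, tsum_const_smul'', RingHom.id_apply]

theorem total_eq_tsum (a : Tail 𝕜 E) : total a = ∑' i, coord i a := rfl

/-- Multiplication by `t`. A sequence lists coefficients in descending degree, so this is the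
backward shift. -/
def shift : Tail 𝕜 E →ₗ[𝕜] Tail 𝕜 E :=
  Finsupp.lcomapDomain (fun i : ℕ => i + 1) (add_left_injective 1)

@[simp] theorem coord_shift (i : ℕ) (a : Tail 𝕜 E) : coord i (shift a) = coord (i + 1) a := rfl

theorem coord_shift_pow (k i : ℕ) (a : Tail 𝕜 E) :
    coord i ((shift ^ k) a) = coord (i + k) a := by
  induction k generalizing i with
  | zero => rfl
  | succ k ih => rw [pow_succ', Module.End.mul_apply, coord_shift, ih, Nat.succ_add_eq_add_succ]

theorem shift_surjective : Function.Surjective (shift : Tail 𝕜 E →ₗ[𝕜] Tail 𝕜 E) := fun a =>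
  ⟨(Finsupp.mapDomain (fun i : ℕ => i + 1) a : ℕ →₀ E),
    ext_coord (Finsupp.mapDomain_apply (add_left_injective 1) (a : ℕ →₀ E))⟩

theorem exists_shift_pow_eq_zero (a : Tail 𝕜 E) : ∃ N, (shift ^ N) a = 0 := by
  obtain ⟨N, hN⟩ := exists_coord_eq_zero a
  refine ⟨N, ext_coord fun i => ?_⟩
  rw [coord_shift_pow, hN _ (Nat.le_add_left N i), map_zero]

theorem inner_eq_inner_coord_zero_add (a b : Tail 𝕜 E) :
    inner 𝕜 a b = inner 𝕜 (coord 0 a) (coord 0 b) + inner 𝕜 (shift a) (shift b) :=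
  (summable_inner_coord a b).tsum_eq_zero_add

theorem total_eq_coord_zero_add (a : Tail 𝕜 E) : total a = coord 0 a + total (shift a) :=
  (summable_coord a).tsum_eq_zero_add

/-- The sequence `(x, 0, 0, …)`. -/
def constant : E →ₗ[𝕜] Tail 𝕜 E := Finsupp.lsingle 0

@[simp] theorem coord_zero_constant (x : E) : coord 0 (constant x : Tail 𝕜 E) = x :=
  Finsupp.single_eq_same

@[simp] theorem shift_constant (x : E) : shift (constant x : Tail 𝕜 E) = 0 :=
  ext_coord fun i => Finsupp.single_eq_of_ne (Nat.succ_ne_zero i)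

theorem inner_constant (x : E) (a : Tail 𝕜 E) :
    inner 𝕜 (constant x) a = inner 𝕜 x (coord 0 a) := by
  rw [inner_eq_inner_coord_zero_add, shift_constant, inner_zero_left, add_zero,
    coord_zero_constant]

variable (𝕜 E) in
theorem ker_shift : LinearMap.ker (shift : Tail 𝕜 E →ₗ[𝕜] Tail 𝕜 E) = LinearMap.range constant := by
  ext a
  rw [LinearMap.mem_ker, LinearMap.mem_range]
  constructor
  · refine fun h => ⟨coord 0 a, ext_coord fun i => ?_⟩
    cases i with
    | zero => simp
    | succ i => rw [← coord_shift, ← coord_shift, h, shift_constant]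
  · rintro ⟨x, rfl⟩
    exact shift_constant x

variable (𝕜 E) in
theorem finrank_ker_shift :
    Module.finrank 𝕜 (LinearMap.ker (shift : Tail 𝕜 E →ₗ[𝕜] Tail 𝕜 E)) = Module.finrank 𝕜 E := by
  rw [ker_shift]
  exact LinearMap.finrank_range_of_inj
    (Function.LeftInverse.injective (g := coord 0) coord_zero_constant)

instance [FiniteDimensional 𝕜 E] :
    FiniteDimensional 𝕜 (LinearMap.ker (shift : Tail 𝕜 E →ₗ[𝕜] Tail 𝕜 E)) := by
  rw [ker_shift]; infer_instance

theorem coord_zero_eq_zero_of_mem_orthogonal {W : Submodule 𝕜 (Tail 𝕜 E)}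
    (h : LinearMap.ker shift ≤ W) {a : Tail 𝕜 E} (ha : a ∈ Wᗮ) : coord 0 a = 0 := by
  have := ha (constant (coord 0 a)) (h (shift_constant _))
  rwa [inner_constant, inner_self_eq_zero] at this

end Tail

section LinearAlgebra

variable {K M N : Type*} [Field K] [AddCommGroup M] [Module K M] [AddCommGroup N] [Module K N]

theorem finrank_map_of_injOn {f : M →ₗ[K] N} {U : Submodule K M} (hf : Set.InjOn f U) :
    Module.finrank K (U.map f) = Module.finrank K U := by
  rw [← LinearMap.range_domRestrict]
  exact LinearMap.finrank_range_of_inj (Set.injOn_iff_injective.mp hf)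

theorem finiteDimensional_comap_of_surjective {f : M →ₗ[K] N} (hf : Function.Surjective f)
    (W : Submodule K N) [FiniteDimensional K W] [FiniteDimensional K (LinearMap.ker f)] :
    FiniteDimensional K (W.comap f) := by
  rw [← Submodule.fg_iff_finiteDimensional]
  refine Submodule.fg_of_fg_map_of_fg_inf_ker f ?_ ?_
  · rw [Submodule.map_comap_eq_of_surjective hf]
    exact (Submodule.fg_iff_finiteDimensional _).mpr inferInstance
  · rw [inf_eq_right.mpr (LinearMap.ker_le_comap f)]
    exact (Submodule.fg_iff_finiteDimensional _).mpr inferInstance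

theorem finrank_comap_of_surjective {f : M →ₗ[K] N} (hf : Function.Surjective f)
    (W : Submodule K N) [FiniteDimensional K W] [FiniteDimensional K (LinearMap.ker f)] :
    Module.finrank K (W.comap f) = Module.finrank K W + Module.finrank K (LinearMap.ker f) := by
  have := finiteDimensional_comap_of_surjective hf W
  rw [← (f.domRestrict (W.comap f)).finrank_range_add_finrank_ker, LinearMap.range_domRestrict,
    Submodule.map_comap_eq_of_surjective hf, LinearMap.ker_domRestrict,
    (Submodule.comapSubtypeEquivOfLe (LinearMap.ker_le_comap f)).finrank_eq]

theorem covBy_of_finrank_eq_add_one {U U' : Submodule K M} (h : U ≤ U')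
    (hr : Module.finrank K U' = Module.finrank K U + 1) : U ⋖ U' := by
  have : FiniteDimensional K U' := Module.finite_of_finrank_pos (by omega)
  refine ⟨h.lt_of_ne fun heq => by rw [heq] at hr; omega, fun T hUT hTU' => ?_⟩
  have := Submodule.finiteDimensional_of_le hTU'.le
  have h₁ := Submodule.finrank_lt_finrank_of_lt hUT
  have h₂ := Submodule.finrank_lt_finrank_of_lt hTU'
  omega

end LinearAlgebra

namespace Tail

variable {𝕜 E : Type*} [RCLike 𝕜] [NormedAddCommGroup E] [InnerProductSpace 𝕜 E]
  {W W' : Submodule 𝕜 (Tail 𝕜 E)}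

/-- The subspace `t⁻¹W`. In particular `W ≤ preimage W` says that `W` is stable under `t`. -/
def preimage (W : Submodule 𝕜 (Tail 𝕜 E)) : Submodule 𝕜 (Tail 𝕜 E) := W.comap shift

theorem mem_preimage {a : Tail 𝕜 E} : a ∈ preimage W ↔ shift a ∈ W := Iff.rfl

theorem preimage_injective :
    Function.Injective (preimage : Submodule 𝕜 (Tail 𝕜 E) → Submodule 𝕜 (Tail 𝕜 E)) :=
  Submodule.comap_injective_of_surjective shift_surjective

theorem preimage_mono (h : W ≤ W') : preimage W ≤ preimage W' := Submodule.comap_mono h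

theorem ker_le_preimage (W : Submodule 𝕜 (Tail 𝕜 E)) : LinearMap.ker shift ≤ preimage W :=
  LinearMap.ker_le_comap shift

/-- The orthogonal complement of `W` in `t⁻¹W`. -/
def gap (W : Submodule 𝕜 (Tail 𝕜 E)) : Submodule 𝕜 (Tail 𝕜 E) := preimage W ⊓ Wᗮ

/-- On the locally nilpotent module `Tail` the map `1 - t` is invertible, and its inverse
`1 + t + t² + ⋯` moves an element of `t⁻¹W` only by an element of `W`. -/
theorem exists_sub_shift_eq (hW : W ≤ preimage W) {a : Tail 𝕜 E} (ha : a ∈ preimage W) :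
    ∃ A, A - shift A = a ∧ shift A ∈ W := by
  obtain ⟨N, hN⟩ := exists_shift_pow_eq_zero a
  induction N generalizing a with
  | zero => exact ⟨0, by rw [map_zero, sub_zero]; exact hN.symm, by simp⟩
  | succ N ih =>
    obtain ⟨A, hA, hAW⟩ := ih (hW ha) (by rwa [pow_succ, Module.End.mul_apply] at hN)
    refine ⟨a + A, ?_, ?_⟩
    · rw [map_add, ← hA]
      abel
    · rw [map_add]
      exact W.add_mem ha hAW

theorem total_sub_shift (a : Tail 𝕜 E) : total (a - shift a) = coord 0 a := by
  rw [map_sub, total_eq_coord_zero_add a, add_sub_cancel_right]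

/-- Write `a = A - tA` and `b = B - tB`. Then `total a` and `total b` are the zeroth entries of `A`
and `B`, whose inner product is `⟪A, B⟫ - ⟪tA, tB⟫`; and `tA`, `tB` lie in `W`, to which `a` and `b`
are orthogonal. -/
theorem inner_total_of_mem_gap (hW : W ≤ preimage W) {a b : Tail 𝕜 E}
    (ha : a ∈ gap W) (hb : b ∈ gap W) : inner 𝕜 (total a) (total b) = inner 𝕜 a b := by
  obtain ⟨A, hA, hAW⟩ := exists_sub_shift_eq hW ha.1
  obtain ⟨B, hB, hBW⟩ := exists_sub_shift_eq hW hb.1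
  have hAb : inner 𝕜 (shift A) b = 0 := hb.2 _ hAW
  have haB : inner 𝕜 a (shift B) = 0 := Submodule.inner_left_of_mem_orthogonal hBW ha.2
  calc inner 𝕜 (total a) (total b)
      = inner 𝕜 (coord 0 A) (coord 0 B) := by
        rw [← total_sub_shift, ← total_sub_shift, hA, hB]
    _ = inner 𝕜 (a + shift A) (b + shift B) - inner 𝕜 (shift A) (shift B) := by
        rw [← hA, ← hB, sub_add_cancel, sub_add_cancel, inner_eq_inner_coord_zero_add A B,
          add_sub_cancel_right]
    _ = inner 𝕜 a b := by
        rw [inner_add_left, inner_add_right, inner_add_right, hAb, haB]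
        ring

theorem injOn_total_gap (hW : W ≤ preimage W) : Set.InjOn total (gap W : Set (Tail 𝕜 E)) := by
  refine LinearMap.injOn_of_disjoint_ker subset_rfl (Submodule.disjoint_def.mpr fun a ha h => ?_)
  rw [← inner_self_eq_zero (𝕜 := 𝕜), ← inner_total_of_mem_gap hW ha ha, LinearMap.mem_ker.mp h,
    inner_zero_left]

/-- The part of the gap lying over `L`. -/
def gapOver (W : Submodule 𝕜 (Tail 𝕜 E)) (L : Submodule 𝕜 E) : Submodule 𝕜 (Tail 𝕜 E) :=
  gap W ⊓ L.comap total

/-- The extension of `W` inside `t⁻¹W` in the direction `L`. -/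
def extend (W : Submodule 𝕜 (Tail 𝕜 E)) (L : Submodule 𝕜 E) : Submodule 𝕜 (Tail 𝕜 E) :=
  W ⊔ gapOver W L

theorem gapOver_le_gap (W : Submodule 𝕜 (Tail 𝕜 E)) (L : Submodule 𝕜 E) : gapOver W L ≤ gap W :=
  inf_le_left

theorem le_extend (W : Submodule 𝕜 (Tail 𝕜 E)) (L : Submodule 𝕜 E) : W ≤ extend W L := le_sup_left

theorem extend_le_preimage (hW : W ≤ preimage W) (L : Submodule 𝕜 E) :
    extend W L ≤ preimage W :=
  sup_le hW ((gapOver_le_gap W L).trans inf_le_left)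

theorem extend_le_preimage_extend (hW : W ≤ preimage W) (L : Submodule 𝕜 E) :
    extend W L ≤ preimage (extend W L) :=
  (extend_le_preimage hW L).trans (preimage_mono (le_extend W L))

theorem extend_inf_orthogonal (W : Submodule 𝕜 (Tail 𝕜 E)) (L : Submodule 𝕜 E) :
    extend W L ⊓ Wᗮ = gapOver W L := by
  have h : gapOver W L ≤ Wᗮ := (gapOver_le_gap W L).trans inf_le_right
  rw [extend, sup_comm, sup_inf_assoc_of_le _ h, Submodule.inf_orthogonal_eq_bot, sup_bot_eq]

theorem gapOver_map_total (hW : W ≤ preimage W) {U : Submodule 𝕜 (Tail 𝕜 E)} (hU : U ≤ gap W) :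
    gapOver W (U.map total) = U := by
  refine le_antisymm ?_ (le_inf hU (Submodule.le_comap_map _ _))
  rintro a ⟨ha, b, hb, hab⟩
  rwa [← injOn_total_gap hW (hU hb) ha hab]

/-- The isometry `total` carries orthogonal directions to orthogonal parts of the gap. -/
theorem gapOver_orthogonal_le_gapOver_extend (hW : W ≤ preimage W) (L : Submodule 𝕜 E) :
    gapOver W Lᗮ ≤ gapOver (extend W L) Lᗮ := by
  refine fun a ha => ⟨⟨preimage_mono (le_extend W L) ha.1.1, ?_⟩, ha.2⟩
  rw [extend, ← Submodule.inf_orthogonal]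
  refine ⟨ha.1.2, fun b hb => ?_⟩
  rw [← inner_total_of_mem_gap hW hb.1 ha.1]
  exact ha.2 _ hb.2

theorem extend_inf_orthogonal_map_total [FiniteDimensional 𝕜 W] (hW : W ≤ preimage W)
    (hWW' : W ≤ W') (hW' : W' ≤ preimage W) : extend W ((W' ⊓ Wᗮ).map total) = W' := by
  rw [extend, gapOver_map_total hW (inf_le_inf_right _ hW'), inf_comm,
    Submodule.sup_orthogonal_inf_of_hasOrthogonalProjection hWW']

theorem finrank_add_finrank_map_total [FiniteDimensional 𝕜 W'] (hW : W ≤ preimage W)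
    (hWW' : W ≤ W') (hW' : W' ≤ preimage W) :
    Module.finrank 𝕜 W + Module.finrank 𝕜 ((W' ⊓ Wᗮ).map total) = Module.finrank 𝕜 W' := by
  rw [finrank_map_of_injOn ((injOn_total_gap hW).mono (inf_le_inf_right _ hW')), inf_comm,
    Submodule.finrank_add_inf_finrank_orthogonal hWW']

/-- The last nonzero power of `t` applied to a vector of `W'` modulo `W`. -/
theorem exists_mem_notMem_shift_mem (hW' : W' ≤ preimage W') (h : ¬W' ≤ W) :
    ∃ a ∈ W', a ∉ W ∧ shift a ∈ W := by
  obtain ⟨a, ha, haW⟩ := SetLike.not_le_iff_exists.mp h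
  obtain ⟨N, hN⟩ := exists_shift_pow_eq_zero a
  induction N generalizing a with
  | zero => exact absurd ((show a = 0 from hN) ▸ W.zero_mem) haW
  | succ N ih =>
    by_cases hta : shift a ∈ W
    · exact ⟨a, ha, haW, hta⟩
    · exact ih (shift a) (hW' ha) hta (by rwa [pow_succ, Module.End.mul_apply] at hN)

theorem le_preimage_of_covBy (hW : W ≤ preimage W) (hW' : W' ≤ preimage W') (h : W ⋖ W') :
    W' ≤ preimage W := by
  obtain ⟨a, ha, haW, hta⟩ := exists_mem_notMem_shift_mem hW' h.lt.not_ge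
  rcases h.eq_or_eq (le_inf h.le hW) inf_le_left with heq | heq
  · exact absurd (heq ▸ ⟨ha, hta⟩ : a ∈ W) haW
  · exact inf_eq_left.mp heq

theorem le_preimage_of_ker_le {W'' : Submodule 𝕜 (Tail 𝕜 E)} (hW' : W' ≤ preimage W)
    (hcov : W' ⋖ W'') (h₁ : ¬LinearMap.ker shift ≤ W') (h₂ : LinearMap.ker shift ≤ W'') :
    W'' ≤ preimage W := by
  have hsup : W' ⊔ LinearMap.ker shift = W'' :=
    (hcov.eq_or_eq le_sup_left (sup_le hcov.le h₂)).resolve_left (left_lt_sup.mpr h₁).ne'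
  exact hsup ▸ sup_le hW' (ker_le_preimage W)

variable [FiniteDimensional 𝕜 E]

instance (W : Submodule 𝕜 (Tail 𝕜 E)) [FiniteDimensional 𝕜 W] : FiniteDimensional 𝕜 (preimage W) :=
  finiteDimensional_comap_of_surjective shift_surjective W

theorem finrank_preimage (W : Submodule 𝕜 (Tail 𝕜 E)) [FiniteDimensional 𝕜 W] :
    Module.finrank 𝕜 (preimage W) = Module.finrank 𝕜 W + Module.finrank 𝕜 E := by
  rw [preimage, finrank_comap_of_surjective shift_surjective, finrank_ker_shift]

variable [FiniteDimensional 𝕜 W]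

instance : FiniteDimensional 𝕜 (gap W) :=
  Submodule.finiteDimensional_of_le (inf_le_left : gap W ≤ preimage W)

instance (L : Submodule 𝕜 E) : FiniteDimensional 𝕜 (gapOver W L) :=
  Submodule.finiteDimensional_of_le (gapOver_le_gap W L)

instance (L : Submodule 𝕜 E) : FiniteDimensional 𝕜 (extend W L) :=
  inferInstanceAs (FiniteDimensional 𝕜 (W ⊔ gapOver W L : Submodule 𝕜 (Tail 𝕜 E)))

theorem map_total_gap (hW : W ≤ preimage W) : (gap W).map total = ⊤ := by
  have h := finrank_add_finrank_map_total hW hW le_rfl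
  rw [finrank_preimage] at h
  exact Submodule.eq_top_of_finrank_eq (Nat.add_left_cancel h)

theorem map_total_gapOver (hW : W ≤ preimage W) (L : Submodule 𝕜 E) :
    (gapOver W L).map total = L := by
  rw [gapOver, ← Submodule.map_inf_eq_map_inf_comap, map_total_gap hW, top_inf_eq]

theorem map_total_extend_inf_orthogonal (hW : W ≤ preimage W) (L : Submodule 𝕜 E) :
    (extend W L ⊓ Wᗮ).map total = L := by
  rw [extend_inf_orthogonal, map_total_gapOver hW]

theorem extend_injective (hW : W ≤ preimage W) : Function.Injective (extend W) :=
  Function.LeftInverse.injective (g := fun U => (U ⊓ Wᗮ).map total)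
    (map_total_extend_inf_orthogonal hW)

theorem finrank_extend (hW : W ≤ preimage W) (L : Submodule 𝕜 E) :
    Module.finrank 𝕜 (extend W L) = Module.finrank 𝕜 W + Module.finrank 𝕜 L := by
  rw [← finrank_add_finrank_map_total hW (le_extend W L) (extend_le_preimage hW L),
    map_total_extend_inf_orthogonal hW]

theorem gap_eq_gapOver_sup_gapOver_orthogonal (hW : W ≤ preimage W) (L : Submodule 𝕜 E) :
    gap W = gapOver W L ⊔ gapOver W Lᗮ := by
  have hle : gapOver W L ⊔ gapOver W Lᗮ ≤ gap W :=
    sup_le (gapOver_le_gap W L) (gapOver_le_gap W Lᗮ)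
  refine (Submodule.eq_of_le_of_finrank_eq hle ?_).symm
  rw [← finrank_map_of_injOn ((injOn_total_gap hW).mono hle), Submodule.map_sup,
    map_total_gapOver hW, map_total_gapOver hW, Submodule.sup_orthogonal_of_hasOrthogonalProjection,
    ← map_total_gap hW, finrank_map_of_injOn (injOn_total_gap hW)]

theorem extend_extend_orthogonal (hW : W ≤ preimage W) (L : Submodule 𝕜 E) :
    extend (extend W L) Lᗮ = preimage W := by
  symm
  apply Submodule.eq_of_le_of_finrank_eq
  · calc preimage W = W ⊔ gap W := by
          rw [gap, inf_comm, Submodule.sup_orthogonal_inf_of_hasOrthogonalProjection hW]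
      _ = extend W L ⊔ gapOver W Lᗮ := by
          rw [gap_eq_gapOver_sup_gapOver_orthogonal hW L, extend, sup_assoc]
      _ ≤ extend (extend W L) Lᗮ :=
          sup_le_sup_left (gapOver_orthogonal_le_gapOver_extend hW L) _
  · rw [finrank_preimage, finrank_extend (extend_le_preimage_extend hW L), finrank_extend hW,
      add_assoc, L.finrank_add_finrank_orthogonal]

theorem extend_preimage (hW : W ≤ preimage W) (L : Submodule 𝕜 E) :
    extend (preimage W) L = preimage (extend W L) := by
  apply Submodule.eq_of_le_of_finrank_eq
  · refine sup_le (preimage_mono (le_extend W L)) ?_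
    rintro a ⟨⟨ha, ha'⟩, (haL : total a ∈ L)⟩
    have h0 := coord_zero_eq_zero_of_mem_orthogonal (ker_le_preimage W) ha'
    refine Submodule.mem_sup_right ⟨⟨ha, fun w hw => ?_⟩, ?_⟩
    · obtain ⟨b, rfl⟩ := shift_surjective w
      rw [← ha' b hw, inner_eq_inner_coord_zero_add b a, h0, inner_zero_right, zero_add]
    · rwa [total_eq_coord_zero_add, h0, zero_add] at haL
  · rw [finrank_extend (preimage_mono hW), finrank_preimage, finrank_preimage, finrank_extend hW,
      add_right_comm]

end Tail

/-! ### Words and matchings -/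

section Words

variable {α : Type*} {χ : α → α}

/-- Deletion of two adjacent letters `x`, `χ x` from a word. -/
inductive CancelStep (χ : α → α) : List α → List α → Prop
  | intro (a : List α) (x : α) (b : List α) : CancelStep χ (a ++ x :: χ x :: b) (a ++ b)

/-- Repeated deletion of adjacent letters `x`, `χ x`. A word that can be reduced to the empty word
in this way will turn out to be the same thing as a flag, as a non-crossing matching of its
positions compatible with `χ`, and as a closed walk in a labelled tree. -/
def Cancels (χ : α → α) : List α → List α → Prop := Relation.ReflTransGen (CancelStep χ)

theorem CancelStep.length_eq {l l' : List α} (h : CancelStep χ l l') :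
    l.length = l'.length + 2 := by
  obtain ⟨a, x, b⟩ := h
  simp only [List.length_append, List.length_cons]
  omega

theorem CancelStep.append_right {l l' : List α} (h : CancelStep χ l l') (c : List α) :
    CancelStep χ (l ++ c) (l' ++ c) := by
  obtain ⟨a, x, b⟩ := h
  simpa using CancelStep.intro a x (b ++ c)

theorem CancelStep.cons (y : α) {l l' : List α} (h : CancelStep χ l l') :
    CancelStep χ (y :: l) (y :: l') := by
  obtain ⟨a, x, b⟩ := h
  exact CancelStep.intro (y :: a) x b

theorem Cancels.cons (y : α) {l l' : List α} (h : Cancels χ l l') :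
    Cancels χ (y :: l) (y :: l') :=
  Relation.ReflTransGen.lift (y :: ·) (fun _ _ => CancelStep.cons y) _ _ h

end Words

@[simp] theorem submodule_chi (L : CP1) : (chi L).submodule = L.submoduleᗮ :=
  Projectivization.submodule_mk'' _ _

@[simp] theorem chi_chi (L : CP1) : chi (chi L) = L :=
  Projectivization.submodule_injective (by simp)

namespace Tail

section Level

variable {𝕜 E : Type*} [RCLike 𝕜] [NormedAddCommGroup E] [InnerProductSpace 𝕜 E]

variable (𝕜 E) in
/-- The kernel of `tⁿ`, as an iterated preimage of zero. It is a copy of `V(n)`. -/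
def level (n : ℕ) : Submodule 𝕜 (Tail 𝕜 E) := preimage^[n] ⊥

theorem level_succ (n : ℕ) : level 𝕜 E (n + 1) = preimage (level 𝕜 E n) :=
  Function.iterate_succ_apply' _ _ _

theorem mem_level {n : ℕ} {a : Tail 𝕜 E} : a ∈ level 𝕜 E n ↔ (shift ^ n) a = 0 := by
  induction n generalizing a with
  | zero => exact Iff.rfl
  | succ n ih => rw [level_succ, mem_preimage, ih, pow_succ, Module.End.mul_apply]

variable [FiniteDimensional 𝕜 E]

instance (n : ℕ) : FiniteDimensional 𝕜 (level 𝕜 E n) := by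
  induction n with
  | zero => exact inferInstanceAs (FiniteDimensional 𝕜 (⊥ : Submodule 𝕜 (Tail 𝕜 E)))
  | succ n ih => rw [level_succ]; infer_instance

theorem finrank_level (n : ℕ) :
    Module.finrank 𝕜 (level 𝕜 E n) = n * Module.finrank 𝕜 E := by
  induction n with
  | zero => rw [zero_mul]; exact finrank_bot 𝕜 (Tail 𝕜 E)
  | succ n ih => rw [level_succ, finrank_preimage, ih, add_one_mul]

end Level

variable {W : Submodule ℂ (Tail ℂ C2)}

/-- The subspace obtained from `W` by successive extension in the directions of a word. -/
def extendWord (W : Submodule ℂ (Tail ℂ C2)) (l : List CP1) : Submodule ℂ (Tail ℂ C2) :=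
  l.foldl (fun U x => extend U x.submodule) W

theorem extendWord_cons (W : Submodule ℂ (Tail ℂ C2)) (x : CP1) (l : List CP1) :
    extendWord W (x :: l) = extendWord (extend W x.submodule) l := rfl

theorem extendWord_append (W : Submodule ℂ (Tail ℂ C2)) (l l' : List CP1) :
    extendWord W (l ++ l') = extendWord (extendWord W l) l' := List.foldl_append

theorem extendWord_concat (W : Submodule ℂ (Tail ℂ C2)) (l : List CP1) (x : CP1) :
    extendWord W (l ++ [x]) = extend (extendWord W l) x.submodule := extendWord_append W l [x]

theorem extendWord_le_preimage (hW : W ≤ preimage W) (l : List CP1) :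
    extendWord W l ≤ preimage (extendWord W l) := by
  induction l generalizing W with
  | nil => exact hW
  | cons _ _ ih => exact ih (extend_le_preimage_extend hW _)

variable [FiniteDimensional ℂ W]

instance (l : List CP1) : FiniteDimensional ℂ (extendWord W l) := by
  induction l using List.reverseRecOn with
  | nil => exact inferInstanceAs (FiniteDimensional ℂ W)
  | append_singleton l x ih => rw [extendWord_concat]; infer_instance

theorem finrank_extendWord (hW : W ≤ preimage W) (l : List CP1) :
    Module.finrank ℂ (extendWord W l) = Module.finrank ℂ W + l.length := by
  induction l using List.reverseRecOn with
  | nil => rfl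
  | append_singleton l x ih =>
    rw [extendWord_concat, finrank_extend (extendWord_le_preimage hW l), ih, x.finrank_submodule,
      List.length_append, List.length_singleton, add_assoc]

theorem extendWord_preimage (hW : W ≤ preimage W) (l : List CP1) :
    extendWord (preimage W) l = preimage (extendWord W l) := by
  induction l using List.reverseRecOn with
  | nil => rfl
  | append_singleton l x ih =>
    rw [extendWord_concat, extendWord_concat, ih, extend_preimage (extendWord_le_preimage hW l)]

theorem extendWord_of_cancelStep (hW : W ≤ preimage W) {l l' : List CP1}
    (h : CancelStep chi l l') : extendWord W l = preimage (extendWord W l') := by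
  obtain ⟨a, x, b⟩ := h
  have ha := extendWord_le_preimage hW a
  rw [extendWord_append, extendWord_cons, extendWord_cons, submodule_chi,
    extend_extend_orthogonal ha, extendWord_preimage ha, extendWord_append]

theorem extendWord_bot_of_cancels {l : List CP1} {n : ℕ} (h : Cancels chi l [])
    (hl : l.length = 2 * n) : extendWord ⊥ l = level ℂ C2 n := by
  induction n generalizing l with
  | zero => rw [List.eq_nil_of_length_eq_zero hl]; rfl
  | succ n ih =>
    obtain rfl | ⟨l', hl', h'⟩ := h.cases_head
    · exact absurd hl (by simp)
    · have := hl'.length_eq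
      rw [extendWord_of_cancelStep bot_le hl', level_succ, ih h' (by omega)]

theorem covBy_extend (hW : W ≤ preimage W) (x : CP1) : W ⋖ extend W x.submodule :=
  covBy_of_finrank_eq_add_one (le_extend W _) (by rw [finrank_extend hW, x.finrank_submodule])

theorem eq_chi_of_ker_le (hW : W ≤ preimage W) {x y : CP1}
    (h₁ : ¬LinearMap.ker shift ≤ extend W x.submodule)
    (h₂ : LinearMap.ker shift ≤ extend (extend W x.submodule) y.submodule) : y = chi x := by
  have hWx := extend_le_preimage_extend hW x.submodule
  have hr := finrank_extend hWx y.submodule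
  have hle := le_preimage_of_ker_le (extend_le_preimage hW x.submodule) (covBy_extend hWx y) h₁ h₂
  have heq : extend (extend W x.submodule) y.submodule = preimage W := by
    refine Submodule.eq_of_le_of_finrank_eq hle ?_
    rw [hr, finrank_extend hW, finrank_preimage, x.finrank_submodule, y.finrank_submodule,
      finrank_euclideanSpace_fin]
  rw [← extend_extend_orthogonal hW x.submodule, ← submodule_chi] at heq
  exact Projectivization.submodule_injective (extend_injective hWx heq)

/-- If `ker t` lies in the subspace of a word, then the shortest initial word whose subspace
contains `ker t` ends in an antipodal pair. -/
theorem exists_cancelStep {l : List CP1} (h : LinearMap.ker shift ≤ extendWord ⊥ l) :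
    ∃ l', CancelStep chi l l' := by
  have hlen : ∀ {l}, LinearMap.ker shift ≤ extendWord ⊥ l → 2 ≤ l.length := fun {l} hl => by
    have := Submodule.finrank_mono hl
    rwa [finrank_ker_shift, finrank_euclideanSpace_fin, finrank_extendWord bot_le, finrank_bot,
      zero_add] at this
  induction l using List.reverseRecOn with
  | nil => simpa using hlen h
  | append_singleton l y ih =>
    by_cases hl : LinearMap.ker shift ≤ extendWord ⊥ l
    · obtain ⟨l', hl'⟩ := ih hl
      exact ⟨_, hl'.append_right [y]⟩
    obtain rfl | ⟨b, x, rfl⟩ := l.eq_nil_or_concat'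
    · simpa using hlen h
    rw [extendWord_concat] at h hl
    rw [extendWord_concat] at h
    rw [eq_chi_of_ker_le (extendWord_le_preimage bot_le b) hl h]
    exact ⟨b, by simpa using CancelStep.intro b x []⟩

theorem cancels_of_extendWord_bot {l : List CP1} {n : ℕ} (h : extendWord ⊥ l = level ℂ C2 n) :
    Cancels chi l [] := by
  induction n generalizing l with
  | zero =>
    have hl := finrank_extendWord bot_le l
    rw [h, finrank_level, finrank_bot, zero_mul, zero_add] at hl
    rw [List.eq_nil_of_length_eq_zero hl.symm]
    exact Relation.ReflTransGen.refl
  | succ n ih =>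
    rw [level_succ] at h
    obtain ⟨l', h'⟩ := exists_cancelStep (l := l) (h ▸ ker_le_preimage _)
    rw [extendWord_of_cancelStep bot_le h'] at h
    exact Relation.ReflTransGen.head h' (ih (preimage_injective h))

end Tail

section Matchings

variable {ι α : Type*} [LinearOrder ι] {χ : α → α} {u : ι → α} {s : Set ι} {τ : ι → ι}

/-- `τ` restricts to a non-crossing matching of `s` that exchanges the labels `x` and `χ x`. Letting
`s` vary makes it possible to build a matching up one pair at a time. -/
structure IsMatchingOn (χ : α → α) (u : ι → α) (s : Set ι) (τ : ι → ι) : Prop where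
  mapsTo : ∀ i ∈ s, τ i ∈ s
  invol : ∀ i ∈ s, τ (τ i) = i
  ne : ∀ i ∈ s, τ i ≠ i
  nonCrossing : ∀ i ∈ s, ∀ j ∈ s, i < j → j < τ i → ¬ τ i < τ j
  label : ∀ i ∈ s, u (τ i) = χ (u i)

theorem IsMatchingOn.insert_pair (hχ : χ.Involutive) (h : IsMatchingOn χ u s τ) {i j : ι}
    (hij : i < j) (hs : ∀ k ∈ s, k < i ∨ j < k) (hu : u j = χ (u i)) :
    IsMatchingOn χ u (insert i (insert j s))
      fun k => if k = i then j else if k = j then i else τ k := by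
  obtain ⟨hmaps, hinvol, hne, hnc, hlabel⟩ := h
  have hχu := hχ (u i)
  constructor <;> grind

theorem exists_isMatchingOn_of_cancels (hχ : χ.Involutive) {L : List ι} (hL : L.Pairwise (· < ·))
    (h : Cancels χ (L.map u) []) : ∃ τ, IsMatchingOn χ u {k | k ∈ L} τ := by
  generalize hl : L.map u = l at h
  induction h using Relation.ReflTransGen.head_induction_on generalizing L with
  | refl =>
    rw [List.map_eq_nil_iff] at hl
    subst hl
    exact ⟨id, by constructor <;> simp⟩
  | head h _ ih =>
    obtain ⟨a, x, b⟩ := h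
    obtain ⟨a, L', rfl, rfl, hL'⟩ := List.map_eq_append_iff.mp hl
    obtain ⟨i, L', rfl, rfl, hL'⟩ := List.map_eq_cons_iff.mp hL'
    obtain ⟨j, b, rfl, hu, rfl⟩ := List.map_eq_cons_iff.mp hL'
    have hsub : (a ++ b).Sublist (a ++ i :: j :: b) :=
      (List.Sublist.refl a).append ((List.sublist_cons_self j b).cons i)
    obtain ⟨τ, hτ⟩ := ih (hL.sublist hsub) (List.map_append ..)
    simp only [List.pairwise_append, List.pairwise_cons, List.mem_cons] at hL
    have hset : {k | k ∈ a ++ i :: j :: b} = insert i (insert j {k | k ∈ a ++ b}) := by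
      ext k
      simp only [Set.mem_ofPred_eq, Set.mem_insert_iff, List.mem_append, List.mem_cons]
      tauto
    rw [hset]
    refine ⟨_, hτ.insert_pair hχ (hL.2.1.1 j (Or.inl rfl)) (fun k hk => ?_) hu⟩
    rcases List.mem_append.mp hk with hk | hk
    exacts [Or.inl (hL.2.2 k hk i (Or.inl rfl)), Or.inr (hL.2.1.2.1 k hk)]

theorem exists_isNonCrossingMatching_of_cancels (hχ : χ.Involutive) {m : ℕ} {u : Fin m → α}
    (h : Cancels χ (List.ofFn u) []) :
    ∃ τ : Equiv.Perm (Fin m), IsNonCrossingMatching τ ∧ ∀ i, u (τ i) = χ (u i) := by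
  rw [List.ofFn_eq_map] at h
  obtain ⟨τ, -, hinvol, hne, hnc, hlabel⟩ :=
    exists_isMatchingOn_of_cancels hχ (List.pairwise_lt_finRange m) h
  simp only [List.mem_finRange, Set.ofPred_true, Set.mem_univ, true_imp_iff]
    at hinvol hne hnc hlabel
  exact ⟨Function.Involutive.toPerm τ hinvol,
    ⟨hinvol, hne, fun ⟨i, j, hij, hji, hτ⟩ => hnc i j hij hji hτ⟩, hlabel⟩

/-- The positions at which a matching opens a pair: the set `K` that corresponds to `τ`. -/
def openers {m : ℕ} (τ : Equiv.Perm (Fin m)) : Finset (Fin m) := {i | i < τ i}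

theorem mem_openers {m : ℕ} {τ : Equiv.Perm (Fin m)} {i : Fin m} : i ∈ openers τ ↔ i < τ i := by
  simp [openers]

namespace IsNonCrossingMatching

variable {m : ℕ} {τ : Equiv.Perm (Fin m)}

theorem compl_openers (h : IsNonCrossingMatching τ) :
    (openers τ)ᶜ = (openers τ).map τ.toEmbedding := by
  ext i
  rw [Finset.mem_compl, Finset.mem_map_equiv, ← Equiv.Perm.inv_def,
    inv_eq_of_mul_eq_one_left (a := τ) (b := τ) (Equiv.ext h.1), mem_openers, mem_openers, h.1,
    not_lt, (h.2.1 i).le_iff_lt]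

theorem two_mul_card_openers (h : IsNonCrossingMatching τ) : 2 * (openers τ).card = m := by
  have hcard := Finset.card_add_card_compl (openers τ)
  rwa [h.compl_openers, Finset.card_map, Fintype.card_fin, ← two_mul] at hcard

theorem isSparse_openers (h : IsNonCrossingMatching τ) : IsSparse (openers τ) := by
  intro j hj
  rw [h.compl_openers, ← Finset.card_map τ.toEmbedding]
  refine Finset.card_lt_card (Finset.ssubset_iff_of_subset ?_ |>.mpr ⟨τ j, ?_, ?_⟩)
  · intro k hk
    obtain ⟨i, hi, rfl⟩ := Finset.mem_map.mp hk
    rw [Finset.mem_filter] at hi ⊢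
    exact ⟨Finset.mem_map_of_mem _ hi.1, hi.2.trans (mem_openers.mp hi.1)⟩
  · exact Finset.mem_filter.mpr ⟨Finset.mem_map_of_mem _ hj, mem_openers.mp hj⟩
  · intro hk
    exact lt_irrefl j (Finset.mem_filter.mp ((Finset.mem_map' _).mp hk)).2

end IsNonCrossingMatching

theorem mem_XPrime_iff {n : ℕ} {u : Fin (2 * n) → CP1} : u ∈ XPrime n ↔
    ∃ τ : Equiv.Perm (Fin (2 * n)), IsNonCrossingMatching τ ∧ ∀ i, u (τ i) = chi (u i) := by
  simp only [XPrime, Set.mem_iUnion]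
  constructor
  · rintro ⟨K, -, τ, h, -, hu⟩
    exact ⟨τ, h, hu⟩
  · rintro ⟨τ, h, hu⟩
    have hcard := h.two_mul_card_openers
    exact ⟨openers τ, ⟨h.isSparse_openers, by omega⟩, τ, h, fun i => mem_openers, hu⟩

end Matchings

section ClosedWalks

theorem cancels_darts_of_isAcyclic {A α : Type*} {χ : α → α} {T : SimpleGraph A}
    (hT : T.IsAcyclic) {m : T.Dart → α} (hm : ∀ e, m e.symm = χ (m e)) {a b : A}
    (w p : T.Walk a b) (hp : p.IsPath) : Cancels χ (w.darts.map m) (p.darts.map m) := by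
  induction w with
  | nil =>
    rw [(SimpleGraph.Walk.isPath_iff_nil.mp hp).eq_nil]
    exact Relation.ReflTransGen.refl
  | @cons a a' b h w ih =>
    by_cases ha : a' ∈ p.support
    · have hsnd := hT.eq_snd_of_adj_start hp h ha
      cases p with
      | nil => exact absurd (SimpleGraph.Walk.mem_support_nil_iff.mp ha) h.ne'
      | cons h' p =>
        rw [SimpleGraph.Walk.snd_cons] at hsnd
        subst hsnd
        exact (ih p hp.of_cons).cons _
    · refine ((ih (.cons h.symm p) (hp.cons ha)).cons (m ⟨(a, a'), h⟩)).tail ?_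
      rw [SimpleGraph.Walk.darts_cons, List.map_cons]
      exact hm ⟨(a, a'), h⟩ ▸ CancelStep.intro [] _ _

theorem exists_polygon_walk_darts_eq_take {n k : ℕ} (hk : k ≤ 2 * n) {v : ZMod (2 * n)}
    (hv : v = k) : ∃ w : (polygon n).graph.Walk 0 v,
      w.darts = (List.ofFn (polygonEdge n)).take k := by
  induction k generalizing v with
  | zero =>
    subst hv
    exact ⟨SimpleGraph.Walk.nil.copy rfl Nat.cast_zero.symm, by simp⟩
  | succ k ih =>
    obtain ⟨w, hw⟩ := ih (by omega) rfl
    rw [Nat.cast_succ] at hv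
    subst hv
    have hadj : (polygon n).graph.Adj k (k + 1) := (polygonEdge n ⟨k, hk⟩).adj
    refine ⟨w.concat hadj, ?_⟩
    rw [SimpleGraph.Walk.darts_concat, hw, List.concat_eq_append,
      ← List.take_concat_get' _ k (by simpa using hk), List.getElem_ofFn]
    rfl

theorem exists_polygon_walk_darts_eq (n : ℕ) :
    ∃ w : (polygon n).graph.Walk 0 0, w.darts = List.ofFn (polygonEdge n) := by
  obtain ⟨w, hw⟩ := exists_polygon_walk_darts_eq_take le_rfl (ZMod.natCast_self (2 * n)).symm
  exact ⟨w, by rw [hw, List.take_of_length_le List.length_ofFn.le]⟩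

theorem cancels_of_mem_Y {n : ℕ} {m : (polygon n).graph.Dart → CP1} (hm : m ∈ Y (polygon n)) :
    Cancels chi (List.ofFn fun i => m (polygonEdge n i)) [] := by
  obtain ⟨s, hs, hT, m', hm', rfl⟩ := hm
  obtain ⟨w, hw⟩ := exists_polygon_walk_darts_eq n
  have h := cancels_darts_of_isAcyclic hT.isAcyclic hm' (w.map ((polygon n).folding s hs)) .nil .nil
  rwa [SimpleGraph.Walk.darts_map, hw, List.map_ofFn, List.map_ofFn] at h

end ClosedWalks

/-! ### Tree foldings -/

section Covering

theorem cast_card_symmDiff {ι : Type*} [DecidableEq ι] (s t : Finset ι) :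
    ((symmDiff s t).card : ZMod 2) = s.card + t.card := by
  have hs := Finset.card_sdiff_add_card_inter s t
  have ht := Finset.card_sdiff_add_card_inter t s
  rw [symmDiff_def, Finset.sup_eq_union, Finset.card_union_of_disjoint disjoint_sdiff_sdiff,
    ← hs, ← ht, Finset.inter_comm t s, Nat.cast_add, Nat.cast_add, Nat.cast_add,
    add_add_add_comm, CharTwo.add_self_eq_zero, add_zero]

/-- The cut `P` separates the ends of `d`, and only `d` crosses it, so `d` is a bridge. -/
theorem isAcyclic_of_forall_dart {A : Type*} {G : SimpleGraph A}
    (h : ∀ d : G.Dart, ∃ P : A → Prop, ¬ (P d.fst ↔ P d.snd) ∧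
      ∀ e : G.Dart, ¬ (P e.fst ↔ P e.snd) → e.edge = d.edge) : G.IsAcyclic := by
  rw [SimpleGraph.isAcyclic_iff_forall_adj_isBridge]
  intro a b hab
  obtain ⟨P, hP, hedge⟩ := h ⟨(a, b), hab⟩
  rw [SimpleGraph.isBridge_iff]
  have hconst {c d : A} (w : (G.deleteEdges {s(a, b)}).Walk c d) : P c ↔ P d := by
    induction w with
    | nil => rfl
    | @cons c d' _ hadj _ ih =>
      rw [SimpleGraph.deleteEdges_adj] at hadj
      exact Iff.trans (by_contra fun hne => hadj.2 (hedge ⟨(c, d'), hadj.1⟩ hne)) ih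
  exact fun ⟨w⟩ => hP (hconst w)

/-- The arcs of a matching that pass over the point `a`, given by their left ends. Arcs join the
midpoints of the intervals `[k, k + 1]`, so that the edge `k` of the polygon crosses one arc. -/
def covering {m : ℕ} (τ : Equiv.Perm (Fin m)) (a : ℕ) : Finset (Fin m) :=
  {k | (k : ℕ) < a ∧ a ≤ τ k}

/-- The left end of the arc at `k`. -/
def leftEnd {m : ℕ} (τ : Equiv.Perm (Fin m)) (k : Fin m) : Fin m := min k (τ k)

namespace IsNonCrossingMatching

variable {m : ℕ} {τ : Equiv.Perm (Fin m)}

theorem leftEnd_apply (h : IsNonCrossingMatching τ) (k : Fin m) :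
    leftEnd τ (τ k) = leftEnd τ k := by
  rw [leftEnd, leftEnd, h.1, min_comm]

theorem leftEnd_eq_iff (h : IsNonCrossingMatching τ) {j k : Fin m} :
    leftEnd τ j = leftEnd τ k ↔ j = k ∨ j = τ k := by
  have hj := h.1 j
  have hk := h.1 k
  unfold leftEnd
  grind

theorem covering_succ (h : IsNonCrossingMatching τ) (k : Fin m) :
    covering τ (k + 1) = symmDiff (covering τ k) {leftEnd τ k} := by
  ext j
  simp only [covering, leftEnd, Finset.mem_symmDiff, Finset.mem_singleton, Finset.mem_filter,
    Finset.mem_univ, true_and]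
  have hj := h.1 j
  have hk := h.1 k
  have hne := h.2.1 k
  grind

theorem covering_eq_symmDiff (h : IsNonCrossingMatching τ) (k : Fin m) :
    covering τ k = symmDiff (covering τ (k + 1)) {leftEnd τ k} := by
  rw [h.covering_succ, symmDiff_symmDiff_cancel_right]

theorem covering_apply_succ (h : IsNonCrossingMatching τ) (k : Fin m) :
    covering τ (τ k + 1) = covering τ k := by
  have key : ∀ k, k < τ k → covering τ (τ k + 1) = covering τ k := by
    intro k hk
    ext j
    simp only [covering, Finset.mem_filter, Finset.mem_univ, true_and]
    have hj := h.1 j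
    have hk' := h.1 k
    have hjk := h.2.2
    simp only [not_exists, not_and] at hjk
    have h₁ := hjk j k
    have h₂ := hjk k j
    grind
  rcases (h.2.1 k).lt_or_gt with hk | hk
  · have hkey := key (τ k) (by rwa [h.1])
    rw [h.1] at hkey
    rw [h.covering_succ, h.leftEnd_apply, ← hkey, ← h.covering_eq_symmDiff]
  · exact key k hk

theorem covering_apply (h : IsNonCrossingMatching τ) (k : Fin m) :
    covering τ (τ k) = covering τ (k + 1) := by
  rw [← h.covering_apply_succ, h.1]

theorem covering_edge_injective (h : IsNonCrossingMatching τ) {j k : Fin m}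
    (h₁ : covering τ j = covering τ k) (h₂ : covering τ (j + 1) = covering τ (k + 1)) :
    j = k := by
  have hjk : leftEnd τ j = leftEnd τ k := by
    rw [h.covering_succ, h.covering_succ, h₁] at h₂
    exact Finset.singleton_injective (symmDiff_right_injective _ h₂)
  refine (h.leftEnd_eq_iff.mp hjk).resolve_right fun hj => ?_
  rw [hj, h.covering_apply, h.covering_succ, symmDiff_eq_left] at h₁
  exact Finset.singleton_ne_empty _ h₁

theorem card_covering (h : IsNonCrossingMatching τ) {a : ℕ} (ha : a ≤ m) :
    ((covering τ a).card : ZMod 2) = a := by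
  induction a with
  | zero => simp [covering]
  | succ a ih =>
    rw [h.covering_succ ⟨a, ha⟩, cast_card_symmDiff, ih (by omega), Finset.card_singleton,
      Nat.cast_one, Nat.cast_succ]

end IsNonCrossingMatching

/-- The arcs of a matching that pass over a vertex of the polygon. -/
def vertexCovering {n : ℕ} (τ : Equiv.Perm (Fin (2 * n))) (v : ZMod (2 * n)) :
    Finset (Fin (2 * n)) := covering τ v.val

theorem vertexCovering_natCast {n a : ℕ} (τ : Equiv.Perm (Fin (2 * n))) (ha : a ≤ 2 * n) :
    vertexCovering τ a = covering τ a := by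
  rcases ha.lt_or_eq with h | rfl
  · rw [vertexCovering, ZMod.val_natCast_of_lt h]
  · have hτ (k : Fin (2 * n)) : ¬ 2 * n ≤ (τ k : ℕ) := (τ k).is_lt.not_ge
    simp [vertexCovering, covering, hτ]

/-- Vertices of the polygon are identified if the same arcs pass over them. -/
def coveringSetoid {n : ℕ} (τ : Equiv.Perm (Fin (2 * n))) : Setoid (ZMod (2 * n)) :=
  Setoid.ker (vertexCovering τ)

/-- The arcs of a matching that pass over a vertex of the quotient. -/
def classCovering {n : ℕ} (τ : Equiv.Perm (Fin (2 * n))) :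
    Quotient (coveringSetoid τ) → Finset (Fin (2 * n)) :=
  Setoid.kerLift (vertexCovering τ)

theorem classCovering_injective {n : ℕ} (τ : Equiv.Perm (Fin (2 * n))) :
    Function.Injective (classCovering τ) :=
  Setoid.kerLift_injective _

theorem exists_eq_polygonEdge {n : ℕ} [NeZero n] (d : (polygon n).graph.Dart) :
    ∃ i, d = polygonEdge n i ∨ d = (polygonEdge n i).symm := by
  obtain ⟨⟨a, b⟩, hab⟩ := d
  obtain rfl | rfl : b = a + 1 ∨ a = b + 1 := hab
  · exact ⟨⟨a.val, a.val_lt⟩, Or.inl (SimpleGraph.Dart.ext _ _ (by simp [polygonEdge]))⟩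
  · exact ⟨⟨b.val, b.val_lt⟩, Or.inr (SimpleGraph.Dart.ext _ _ (by simp [polygonEdge]))⟩

namespace IsNonCrossingMatching

variable {n : ℕ} [NeZero n] {τ : Equiv.Perm (Fin (2 * n))}

theorem foldable_coveringSetoid (h : IsNonCrossingMatching τ) :
    (polygon n).Foldable (coveringSetoid τ) := by
  have key (v : ZMod (2 * n)) : polygonParity n v = ((vertexCovering τ v).card : ZMod 2) := by
    rw [vertexCovering, h.card_covering v.val_lt.le, ← map_natCast (polygonParity n),
      ZMod.natCast_zmod_val]
  intro u v huv
  change polygonParity n u = polygonParity n v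
  rw [key, key, show vertexCovering τ u = vertexCovering τ v from huv]

/-- The image of the edge `k` of the polygon in the quotient by `coveringSetoid`. -/
def foldedEdge (h : IsNonCrossingMatching τ) (k : Fin (2 * n)) :
    ((polygon n).quotient (coveringSetoid τ)).Dart :=
  ((polygon n).folding _ h.foldable_coveringSetoid).mapDart (polygonEdge n k)

theorem classCovering_foldedEdge_fst (h : IsNonCrossingMatching τ) (k : Fin (2 * n)) :
    classCovering τ (h.foldedEdge k).fst = covering τ k :=
  vertexCovering_natCast τ k.is_le'

theorem classCovering_foldedEdge_snd (h : IsNonCrossingMatching τ) (k : Fin (2 * n)) :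
    classCovering τ (h.foldedEdge k).snd = covering τ (k + 1) := by
  rw [← vertexCovering_natCast τ k.is_lt, Nat.cast_succ]
  rfl

theorem foldedEdge_apply (h : IsNonCrossingMatching τ) (k : Fin (2 * n)) :
    h.foldedEdge (τ k) = (h.foldedEdge k).symm := by
  refine SimpleGraph.Dart.ext _ _ (Prod.ext ?_ ?_) <;> apply classCovering_injective
  · exact (h.classCovering_foldedEdge_fst _).trans
      ((h.covering_apply k).trans (h.classCovering_foldedEdge_snd k).symm)
  · exact (h.classCovering_foldedEdge_snd _).trans
      ((h.covering_apply_succ k).trans (h.classCovering_foldedEdge_fst k).symm)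

theorem foldedEdge_bijective (h : IsNonCrossingMatching τ) :
    Function.Bijective h.foldedEdge := by
  constructor
  · intro j k hjk
    apply h.covering_edge_injective
    · rw [← h.classCovering_foldedEdge_fst, hjk, h.classCovering_foldedEdge_fst]
    · rw [← h.classCovering_foldedEdge_snd, hjk, h.classCovering_foldedEdge_snd]
  · rintro ⟨⟨a, b⟩, hab⟩
    obtain ⟨-, u, v, huv, rfl, rfl⟩ := id hab
    obtain ⟨k, hk | hk⟩ := exists_eq_polygonEdge ⟨(u, v), huv⟩
    · exact ⟨k, by cases hk; rfl⟩
    · exact ⟨τ k, (h.foldedEdge_apply k).trans (by cases hk; rfl)⟩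

theorem isTree_quotient_coveringSetoid (h : IsNonCrossingMatching τ) :
    ((polygon n).quotient (coveringSetoid τ)).IsTree := by
  refine ⟨(polygon n).connected.map ((polygon n).folding _ h.foldable_coveringSetoid)
    Quotient.mk_surjective, isAcyclic_of_forall_dart fun d => ?_⟩
  obtain ⟨k, rfl⟩ := h.foldedEdge_bijective.2 d
  have mem_iff (j : Fin (2 * n)) : (leftEnd τ k ∈ classCovering τ (h.foldedEdge j).fst ↔
      leftEnd τ k ∈ classCovering τ (h.foldedEdge j).snd) ↔ ¬ (j = k ∨ j = τ k) := by
    rw [h.classCovering_foldedEdge_fst, h.classCovering_foldedEdge_snd, h.covering_succ,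
      Finset.mem_symmDiff, Finset.mem_singleton, ← h.leftEnd_eq_iff, eq_comm (a := leftEnd τ j)]
    tauto
  refine ⟨fun a => leftEnd τ k ∈ classCovering τ a, by simp [mem_iff], fun e he => ?_⟩
  obtain ⟨j, rfl⟩ := h.foldedEdge_bijective.2 e
  rw [mem_iff, not_not] at he
  rcases he with rfl | rfl
  · rfl
  · rw [h.foldedEdge_apply, SimpleGraph.Dart.edge_symm]

end IsNonCrossingMatching

theorem exists_mem_Y {n : ℕ} [NeZero n] {u : Fin (2 * n) → CP1} (hu : u ∈ XPrime n) :
    ∃ m ∈ Y (polygon n), ∀ i, m (polygonEdge n i) = u i := by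
  obtain ⟨τ, h, hu⟩ := mem_XPrime_iff.mp hu
  let e := Equiv.ofBijective _ h.foldedEdge_bijective
  refine ⟨_, ⟨coveringSetoid τ, h.foldable_coveringSetoid, h.isTree_quotient_coveringSetoid,
    u ∘ e.symm, fun d => ?_, rfl⟩, fun i => congrArg u (e.symm_apply_apply i)⟩
  obtain ⟨k, rfl⟩ := e.surjective d
  rw [Function.comp_apply, Function.comp_apply, e.symm_apply_apply, ← hu]
  exact congrArg u ((e.symm_apply_eq).mpr (h.foldedEdge_apply k).symm)

end Covering

theorem mem_XPrime_iff_cancels {n : ℕ} {u : Fin (2 * n) → CP1} :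
    u ∈ XPrime n ↔ Cancels chi (List.ofFn u) [] := by
  refine ⟨fun hu => ?_, fun h =>
    mem_XPrime_iff.mpr (exists_isNonCrossingMatching_of_cancels chi_chi h)⟩
  rcases n.eq_zero_or_pos with rfl | hn
  · exact Relation.ReflTransGen.refl
  · have : NeZero n := ⟨hn.ne'⟩
    obtain ⟨m, hm, hmu⟩ := exists_mem_Y hu
    simpa only [hmu] using cancels_of_mem_Y hm

theorem mem_XPrime_of_mem_Y {n : ℕ} {m : (polygon n).graph.Dart → CP1} (hm : m ∈ Y (polygon n)) :
    (fun i => m (polygonEdge n i)) ∈ XPrime n :=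
  mem_XPrime_iff_cancels.mpr (cancels_of_mem_Y hm)

theorem Y_subset_Y1 {A : Type*} (G : ParityGraph A) : Y G ⊆ Y1 G.graph := by
  rintro _ ⟨s, hs, -, m', hm', rfl⟩ e
  exact hm' ((G.folding s hs).mapDart e)

/-! ### Flags and words -/

namespace Tail

variable {𝕜 E : Type*} [RCLike 𝕜] [NormedAddCommGroup E] [InnerProductSpace 𝕜 E] {n : ℕ}

/-- Extension of a vector of length `n` by zeros. -/
def ofFn : (Fin n → E) →ₗ[𝕜] Tail 𝕜 E :=
  Finsupp.lmapDomain E 𝕜 Fin.val ∘ₗ (Finsupp.linearEquivFunOnFinite 𝕜 E (Fin n)).symm.toLinearMap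

theorem coord_ofFn (v : Fin n → E) (i : Fin n) : coord i (ofFn v : Tail 𝕜 E) = v i :=
  Finsupp.mapDomain_apply Fin.val_injective _ i

theorem coord_ofFn_of_le (v : Fin n → E) {i : ℕ} (hi : n ≤ i) :
    coord i (ofFn v : Tail 𝕜 E) = 0 :=
  Finsupp.mapDomain_of_notMem_range _ i fun ⟨k, hk⟩ => absurd k.isLt (by omega)

theorem ofFn_mem_level (v : Fin n → E) : (ofFn v : Tail 𝕜 E) ∈ level 𝕜 E n :=
  mem_level.mpr <| ext_coord fun i => by
    rw [coord_shift_pow, coord_ofFn_of_le v (Nat.le_add_left n i), map_zero]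

theorem inner_ofFn (v w : Fin n → E) :
    inner 𝕜 (ofFn v : Tail 𝕜 E) (ofFn w) = ∑ i, inner 𝕜 (v i) (w i) := by
  rw [inner_eq_tsum, tsum_eq_sum (s := Finset.range n), Finset.sum_range]
  · simp only [coord_ofFn]
  · intro i hi
    rw [coord_ofFn_of_le v (by simpa using hi), inner_zero_left]

theorem total_ofFn (v : Fin n → E) : total (ofFn v : Tail 𝕜 E) = ∑ i, v i := by
  rw [total_eq_tsum, tsum_eq_sum (s := Finset.range n), Finset.sum_range]
  · simp only [coord_ofFn]
  · exact fun i hi => coord_ofFn_of_le v (by simpa using hi)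

end Tail

theorem coeff_modByMonic_X_pow {R : Type*} [CommRing R] {n k : ℕ} (hk : k < n) (f : R[X]) :
    (f %ₘ X ^ n).coeff k = f.coeff k := by
  conv_rhs => rw [← modByMonic_add_div f (X ^ n)]
  rw [coeff_add, coeff_X_pow_mul', if_neg (by omega), add_zero]

theorem coeffVec_X_smul {n : ℕ} (i : Fin n) (a : V n) (j : Fin 2) :
    coeffVec i ((X : ℂ[X]) • a) j = (X * reduced n (a j)).coeff i := by
  have h : (X : ℂ[X]) • a j = Ideal.Quotient.mk _ (X * reduced n (a j)) := by
    conv_lhs => rw [← mk_reduced n (a j)]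
    rfl
  change (reduced n ((X : ℂ[X]) • a j)).coeff i = _
  rw [h, reduced_mk, coeff_modByMonic_X_pow i.isLt]

theorem finrank_V (n : ℕ) : Module.finrank ℂ (V n) = n * Module.finrank ℂ C2 := by
  let b := AdjoinRoot.powerBasis' (monic_X_pow (R := ℂ) n)
  have : Module.Finite ℂ (ℂ[X] ⧸ Ideal.span {(X : ℂ[X]) ^ n}) := b.finite
  have hb : Module.finrank ℂ (ℂ[X] ⧸ Ideal.span {(X : ℂ[X]) ^ n}) = n :=
    b.finrank.trans (natDegree_X_pow n)
  change Module.finrank ℂ (Fin 2 → ℂ[X] ⧸ Ideal.span {(X : ℂ[X]) ^ n}) = _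
  rw [Module.finrank_pi_fintype, Fin.sum_univ_two, hb, finrank_euclideanSpace_fin, mul_two]

/-- The isometric embedding of `V(n)` into the space of finitely supported sequences which lists
the coefficients in descending degree. -/
def embed (n : ℕ) : V n →ₗᵢ[ℂ] Tail ℂ C2 :=
  LinearMap.isometryOfInner
    { toFun a := Tail.ofFn fun i : Fin n => coeffVec i.rev a
      map_add' a b := by simp only [coeffVec_add]; exact map_add Tail.ofFn _ _
      map_smul' c a := by simp only [coeffVec_smul]; exact map_smul Tail.ofFn _ _ }
    fun a b => (Tail.inner_ofFn _ _).trans <|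
      Equiv.sum_comp Fin.revPerm fun i => inner ℂ (coeffVec i a) (coeffVec i b)

variable {n : ℕ}

theorem coord_embed (i : Fin n) (a : V n) : Tail.coord i (embed n a) = coeffVec i.rev a :=
  Tail.coord_ofFn _ i

theorem coord_embed_of_le {i : ℕ} (hi : n ≤ i) (a : V n) : Tail.coord i (embed n a) = 0 :=
  Tail.coord_ofFn_of_le _ hi

theorem total_embed (a : V n) : Tail.total (embed n a) = omega n a :=
  (Tail.total_ofFn _).trans (Equiv.sum_comp Fin.revPerm fun i => coeffVec i a)

theorem embed_X_smul (a : V n) : embed n ((X : ℂ[X]) • a) = Tail.shift (embed n a) := by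
  refine Tail.ext_coord fun i => ?_
  rw [Tail.coord_shift]
  rcases lt_or_ge i n with hi | hi
  · ext j
    rw [coord_embed ⟨i, hi⟩, coeffVec_X_smul, Fin.val_rev]
    rcases Nat.lt_or_ge (i + 1) n with hi' | hi'
    · obtain ⟨k, rfl⟩ := Nat.exists_eq_add_of_lt hi'
      rw [coord_embed ⟨i + 1, hi'⟩, show i + 1 + k + 1 - (i + 1) = k + 1 by omega, coeff_X_mul]
      simp only [coeffVec, Fin.val_rev, show i + 1 + k + 1 - (i + 1 + 1) = k by omega]
    · rw [coord_embed_of_le hi', Nat.sub_eq_zero_of_le hi', coeff_X_mul_zero]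
      rfl
  · rw [coord_embed_of_le hi, coord_embed_of_le (hi.trans i.le_succ)]

theorem range_embed (n : ℕ) : LinearMap.range (embed n).toLinearMap = Tail.level ℂ C2 n := by
  apply Submodule.eq_of_le_of_finrank_eq
  · rintro _ ⟨a, rfl⟩
    exact Tail.ofFn_mem_level _
  · rw [LinearMap.finrank_range_of_inj (embed n).injective, finrank_V, Tail.finrank_level]

theorem map_embed_inf_orthogonal (U U' : Submodule ℂ (V n)) :
    (U ⊓ U'ᗮ).map (embed n).toLinearMap =
      U.map (embed n).toLinearMap ⊓ (U'.map (embed n).toLinearMap)ᗮ := by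
  rw [Submodule.map_inf _ (embed n).injective, Submodule.map_orthogonal, ← inf_assoc,
    inf_right_comm, inf_eq_left.mpr LinearMap.map_le_range]

section PolynomialSubmodule

variable {R M : Type*} [CommSemiring R] [AddCommMonoid M] [Module R M] [Module R[X] M]
  [IsScalarTower R R[X] M]

theorem polynomial_smul_mem {U : Submodule R M} (hU : ∀ a ∈ U, (X : R[X]) • a ∈ U) (p : R[X])
    {a : M} (ha : a ∈ U) : p • a ∈ U := by
  have hX : ∀ k, (X ^ k : R[X]) • a ∈ U := fun k => by
    induction k with
    | zero => rwa [pow_zero, one_smul]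
    | succ k ih => rw [pow_succ', mul_smul]; exact hU _ ih
  induction p using Polynomial.induction_on' with
  | add p q hp hq => rw [add_smul]; exact U.add_mem hp hq
  | monomial k c =>
    rw [← C_mul_X_pow_eq_monomial, ← smul_eq_C_mul, smul_assoc]
    exact U.smul_mem c (hX k)

/-- The `R[X]`-submodule underlying an `R`-submodule which is stable under `X`. -/
def polynomialSubmodule (U : Submodule R M) (hU : ∀ a ∈ U, (X : R[X]) • a ∈ U) :
    Submodule R[X] M :=
  { U with smul_mem' := fun p _ ha => polynomial_smul_mem hU p ha }

end PolynomialSubmodule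

namespace FlagVariety

theorem subspace_injective : Function.Injective (subspace : FlagVariety n → _) := fun _ _ h =>
  Subtype.ext <| funext fun i =>
    Submodule.restrictScalars_injective ℂ ℂ[X] (V n) (congrFun h i)

theorem subspace_zero (W : FlagVariety n) : W.subspace 0 = ⊥ :=
  congrArg (Submodule.restrictScalars ℂ) W.2.1

theorem subspace_last (W : FlagVariety n) : W.subspace (Fin.last (2 * n)) = ⊤ :=
  congrArg (Submodule.restrictScalars ℂ) W.2.2.1

theorem X_smul_mem (W : FlagVariety n) (i : Fin (2 * n + 1)) {a : V n} (ha : a ∈ W.subspace i) :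
    (X : ℂ[X]) • a ∈ W.subspace i :=
  (W.1 i).smul_mem X ha

theorem subspace_strictMono (W : FlagVariety n) : StrictMono W.subspace :=
  Fin.strictMono_iff_lt_succ.mpr W.2.2.2

/-- The dimensions form a strictly increasing map from `{0, …, 2n}` to itself. -/
theorem finrank_subspace (W : FlagVariety n) (i : Fin (2 * n + 1)) :
    Module.finrank ℂ (W.subspace i) = i := by
  have hle : ∀ i, Module.finrank ℂ (W.subspace i) < 2 * n + 1 := fun i => by
    have := (W.subspace i).finrank_le
    rw [finrank_V, finrank_euclideanSpace_fin] at this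
    omega
  have hmono : StrictMono fun i => (⟨_, hle i⟩ : Fin (2 * n + 1)) := fun i j hij =>
    Submodule.finrank_lt_finrank_of_lt (W.subspace_strictMono hij)
  exact congrArg Fin.val (le_antisymm hmono.apply_le hmono.le_apply)

theorem mem_range_subspace_iff {U : Fin (2 * n + 1) → Submodule ℂ (V n)} :
    U ∈ Set.range (subspace (n := n)) ↔
      (∀ i, ∀ a ∈ U i, (X : ℂ[X]) • a ∈ U i) ∧ Monotone U ∧ ∀ i, Module.finrank ℂ (U i) = i := by
  constructor
  · rintro ⟨W, rfl⟩
    exact ⟨fun i a => W.X_smul_mem i, W.subspace_strictMono.monotone, W.finrank_subspace⟩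
  · rintro ⟨hX, hU, hr⟩
    have hinj := Submodule.restrictScalars_injective ℂ ℂ[X] (V n)
    have hbot : U 0 = ⊥ := Submodule.finrank_eq_zero.mp (hr 0)
    have htop : U (Fin.last (2 * n)) = ⊤ := Submodule.eq_top_of_finrank_eq <| by
      rw [hr, finrank_V, finrank_euclideanSpace_fin, Fin.val_last, mul_comm]
    have hlt (i : Fin (2 * n)) : U i.castSucc < U i.succ :=
      (hU i.castSucc_lt_succ.le).lt_of_ne fun h => by
        have := hr i.succ
        rw [← h, hr, Fin.val_succ, Fin.val_castSucc] at this
        omega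
    exact ⟨⟨fun i => polynomialSubmodule (U i) (hX i), hinj hbot, hinj htop, hlt⟩, rfl⟩

/-- The `i`-th term of a flag as a space of finitely supported sequences. -/
def tail (W : FlagVariety n) (i : Fin (2 * n + 1)) : Submodule ℂ (Tail ℂ C2) :=
  (W.subspace i).map (embed n).toLinearMap

instance (W : FlagVariety n) (i : Fin (2 * n + 1)) : FiniteDimensional ℂ (W.tail i) :=
  inferInstanceAs (FiniteDimensional ℂ ((W.subspace i).map (embed n).toLinearMap))

theorem tail_injective : Function.Injective (tail : FlagVariety n → _) := fun _ _ h =>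
  subspace_injective <| funext fun i =>
    Submodule.map_injective_of_injective (embed n).injective (congrFun h i)

theorem finrank_tail (W : FlagVariety n) (i : Fin (2 * n + 1)) :
    Module.finrank ℂ (W.tail i) = i :=
  (finrank_map_of_injOn (embed n).injective.injOn).trans (W.finrank_subspace i)

theorem tail_le_preimage (W : FlagVariety n) (i : Fin (2 * n + 1)) :
    W.tail i ≤ Tail.preimage (W.tail i) := by
  rintro _ ⟨a, ha, rfl⟩
  exact ⟨_, W.X_smul_mem i ha, embed_X_smul a⟩

theorem tail_covBy (W : FlagVariety n) (i : Fin (2 * n)) : W.tail i.castSucc ⋖ W.tail i.succ := by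
  refine covBy_of_finrank_eq_add_one
    (Submodule.map_mono (W.subspace_strictMono i.castSucc_lt_succ).le) ?_
  rw [finrank_tail, finrank_tail, Fin.val_succ, Fin.val_castSucc]

theorem tail_succ_le_preimage (W : FlagVariety n) (i : Fin (2 * n)) :
    W.tail i.succ ≤ Tail.preimage (W.tail i.castSucc) :=
  Tail.le_preimage_of_covBy (W.tail_le_preimage _) (W.tail_le_preimage _) (W.tail_covBy i)

theorem omegaLine_eq (W : FlagVariety n) (i : Fin (2 * n)) :
    omegaLine W i = (W.tail i.succ ⊓ (W.tail i.castSucc)ᗮ).map Tail.total := by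
  rw [tail, tail, ← map_embed_inf_orthogonal, ← Submodule.map_comp]
  exact congrArg (Submodule.map · _) (LinearMap.ext fun a => (total_embed a).symm)

theorem finrank_omegaLine (W : FlagVariety n) (i : Fin (2 * n)) :
    Module.finrank ℂ (omegaLine W i) = 1 := by
  have h := Tail.finrank_add_finrank_map_total (W.tail_le_preimage i.castSucc) (W.tail_covBy i).le
    (W.tail_succ_le_preimage i)
  rw [← omegaLine_eq, finrank_tail, finrank_tail, Fin.val_succ, Fin.val_castSucc] at h
  omega

/-- The line `ω(Wᵢ ⊖ Wᵢ₋₁)` as a point of `ℂP¹`, with the indexing of `omegaLine`. -/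
def line (W : FlagVariety n) (i : Fin (2 * n)) : CP1 :=
  Projectivization.mk'' (omegaLine W i) (W.finrank_omegaLine i)

theorem submodule_line (W : FlagVariety n) (i : Fin (2 * n)) :
    (W.line i).submodule = omegaLine W i :=
  Projectivization.submodule_mk'' _ _

theorem extend_tail_line (W : FlagVariety n) (i : Fin (2 * n)) :
    Tail.extend (W.tail i.castSucc) (W.line i).submodule = W.tail i.succ := by
  rw [submodule_line, omegaLine_eq]
  exact Tail.extend_inf_orthogonal_map_total (W.tail_le_preimage _) (W.tail_covBy i).le
    (W.tail_succ_le_preimage i)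

end FlagVariety

/-- The subspace reached from `0` by the first `i` letters of the word `u`. -/
def prefixSpace {m : ℕ} (u : Fin m → CP1) (i : ℕ) : Submodule ℂ (Tail ℂ C2) :=
  Tail.extendWord ⊥ ((List.ofFn u).take i)

instance {m : ℕ} (u : Fin m → CP1) (i : ℕ) : FiniteDimensional ℂ (prefixSpace u i) :=
  inferInstanceAs (FiniteDimensional ℂ (Tail.extendWord ⊥ _))

theorem prefixSpace_succ {m : ℕ} (u : Fin m → CP1) (i : Fin m) :
    prefixSpace u (i + 1) = Tail.extend (prefixSpace u i) (u i).submodule := by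
  rw [prefixSpace, ← List.take_concat_get' _ _ (by simp), Tail.extendWord_concat, List.getElem_ofFn]
  rfl

theorem prefixSpace_eq_extendWord {m : ℕ} (u : Fin m → CP1) :
    prefixSpace u m = Tail.extendWord ⊥ (List.ofFn u) := by
  rw [prefixSpace, List.take_of_length_le (List.length_ofFn (f := u)).le]

theorem prefixSpace_le_preimage {m : ℕ} (u : Fin m → CP1) (i : ℕ) :
    prefixSpace u i ≤ Tail.preimage (prefixSpace u i) :=
  Tail.extendWord_le_preimage bot_le _

theorem prefixSpace_mono {m : ℕ} (u : Fin m → CP1) :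
    Monotone fun i : Fin (m + 1) => prefixSpace u i := by
  refine Fin.monotone_iff_le_succ.mpr fun i => ?_
  rw [Fin.val_succ, Fin.val_castSucc, prefixSpace_succ]
  exact Tail.le_extend _ _

theorem finrank_prefixSpace {m : ℕ} (u : Fin m → CP1) (i : Fin (m + 1)) :
    Module.finrank ℂ (prefixSpace u i) = i := by
  rw [prefixSpace, Tail.finrank_extendWord bot_le, finrank_bot, zero_add, List.length_take,
    List.length_ofFn, Nat.min_eq_left i.is_le]

namespace FlagVariety

theorem tail_eq_prefixSpace (W : FlagVariety n) (i : Fin (2 * n + 1)) :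
    W.tail i = prefixSpace W.line i := by
  induction i using Fin.induction with
  | zero => rw [tail, subspace_zero, Submodule.map_bot]; rfl
  | succ i ih => rw [Fin.val_succ, prefixSpace_succ, ← extend_tail_line, ih, Fin.val_castSucc]

theorem line_injective : Function.Injective (line : FlagVariety n → _) := fun W W' h =>
  tail_injective <| funext fun i => by rw [tail_eq_prefixSpace, tail_eq_prefixSpace, h]

theorem line_mem_XPrime (W : FlagVariety n) : W.line ∈ XPrime n := by
  refine mem_XPrime_iff_cancels.mpr (Tail.cancels_of_extendWord_bot (n := n) ?_)
  rw [← prefixSpace_eq_extendWord, ← range_embed, ← Submodule.map_top, ← W.subspace_last]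
  exact (W.tail_eq_prefixSpace (Fin.last _)).symm

theorem exists_tail_eq_prefixSpace {u : Fin (2 * n) → CP1} (hu : u ∈ XPrime n) :
    ∃ W : FlagVariety n, ∀ i, W.tail i = prefixSpace u i := by
  have hlast : prefixSpace u (2 * n) = LinearMap.range (embed n).toLinearMap := by
    rw [range_embed, prefixSpace_eq_extendWord,
      Tail.extendWord_bot_of_cancels (mem_XPrime_iff_cancels.mp hu) List.length_ofFn]
  let U (i : Fin (2 * n + 1)) := (prefixSpace u i).comap (embed n).toLinearMap
  have hU (i) : (U i).map (embed n).toLinearMap = prefixSpace u i :=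
    Submodule.map_comap_eq_of_le (hlast ▸ prefixSpace_mono u i.le_last)
  have hX (i) (a) (ha : a ∈ U i) : (X : ℂ[X]) • a ∈ U i := by
    rw [Submodule.mem_comap, LinearIsometry.coe_toLinearMap, embed_X_smul]
    exact prefixSpace_le_preimage u i ha
  have hr (i) : Module.finrank ℂ (U i) = i := by
    rw [← finrank_map_of_injOn (f := (embed n).toLinearMap) (embed n).injective.injOn, hU,
      finrank_prefixSpace]
  obtain ⟨W, hW⟩ := mem_range_subspace_iff.mpr
    ⟨hX, fun _ _ hij => Submodule.comap_mono (prefixSpace_mono u hij), hr⟩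
  exact ⟨W, fun i => by rw [tail, hW, hU]⟩

theorem exists_line_eq {u : Fin (2 * n) → CP1} (hu : u ∈ XPrime n) :
    ∃ W : FlagVariety n, W.line = u := by
  obtain ⟨W, hW⟩ := exists_tail_eq_prefixSpace hu
  refine ⟨W, funext fun i => Projectivization.submodule_injective ?_⟩
  rw [submodule_line, omegaLine_eq, hW, hW, Fin.val_succ, Fin.val_castSucc, prefixSpace_succ]
  exact Tail.map_total_extend_inf_orthogonal (prefixSpace_le_preimage u i) _

end FlagVariety

/-! ### Topology -/

section Projections

variable {𝕜 E F : Type*} [RCLike 𝕜] [NormedAddCommGroup E] [InnerProductSpace 𝕜 E]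
  [NormedAddCommGroup F] [InnerProductSpace 𝕜 F]

theorem starProjection_map_of_inner_eq [CompleteSpace E] [CompleteSpace F] (f : E →L[𝕜] F)
    {U : Submodule 𝕜 E} [U.HasOrthogonalProjection]
    [(U.map f.toLinearMap).HasOrthogonalProjection]
    (hf : ∀ a ∈ U, ∀ b ∈ U, inner 𝕜 (f a) (f b) = inner 𝕜 a b) :
    (U.map f.toLinearMap).starProjection = f ∘L U.starProjection ∘L f.adjoint := by
  ext v
  refine Submodule.eq_starProjection_of_mem_orthogonal
    ⟨_, U.starProjection_apply_mem (f.adjoint v), rfl⟩ ?_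
  rintro _ ⟨a, ha, rfl⟩
  have hproj : inner 𝕜 a (U.starProjection (f.adjoint v)) = inner 𝕜 a (f.adjoint v) := by
    rw [← Submodule.inner_starProjection_left_eq_right, Submodule.starProjection_eq_self_iff.mpr ha]
  rw [inner_sub_right, sub_eq_zero]
  calc inner 𝕜 (f a) v = inner 𝕜 a (f.adjoint v) := (f.adjoint_inner_right a v).symm
    _ = inner 𝕜 (f a) (f (U.starProjection (f.adjoint v))) := by
      rw [hf a ha _ (U.starProjection_apply_mem _), hproj]

theorem starProjection_inf_orthogonal {U U' : Submodule 𝕜 E} [U.HasOrthogonalProjection]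
    [U'.HasOrthogonalProjection] [(U' ⊓ Uᗮ).HasOrthogonalProjection] (h : U ≤ U') :
    (U' ⊓ Uᗮ).starProjection = U'.starProjection - U.starProjection := by
  ext v
  have hcomp : U.starProjection (U'.starProjection v) = U.starProjection v :=
    congrArg (· v) (Submodule.starProjection_comp_starProjection_of_le h)
  refine Submodule.eq_starProjection_of_mem_orthogonal ⟨?_, ?_⟩ fun b hb => ?_
  · exact U'.sub_mem (U'.starProjection_apply_mem v) (h (U.starProjection_apply_mem v))
  · rw [sub_apply, ← hcomp]
    exact U.sub_starProjection_mem_orthogonal _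
  · have h₁ := U'.sub_starProjection_mem_orthogonal v b hb.1
    have h₂ := Submodule.inner_left_of_mem_orthogonal (U.starProjection_apply_mem v) hb.2
    rw [sub_apply, ← sub_add, inner_add_right, h₁, h₂, add_zero]

theorem starProjection_mul_mul_starProjection_eq_iff {U U' : Submodule 𝕜 E}
    [U.HasOrthogonalProjection] [U'.HasOrthogonalProjection] {T : E →L[𝕜] E} :
    U'.starProjection * T * U.starProjection = T * U.starProjection ↔ ∀ a ∈ U, T a ∈ U' := by
  constructor
  · intro h a ha
    have hTa : U'.starProjection (T (U.starProjection a)) = T (U.starProjection a) :=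
      congrArg (· a) h
    rw [Submodule.starProjection_eq_self_iff.mpr ha] at hTa
    exact Submodule.starProjection_eq_self_iff.mp hTa
  · exact fun h => ContinuousLinearMap.ext fun v => Submodule.starProjection_eq_self_iff.mpr <|
      h _ (U.starProjection_apply_mem v)

theorem starProjection_mul_starProjection_eq_iff {U U' : Submodule 𝕜 E}
    [U.HasOrthogonalProjection] [U'.HasOrthogonalProjection] :
    U'.starProjection * U.starProjection = U.starProjection ↔ U ≤ U' := by
  have h := starProjection_mul_mul_starProjection_eq_iff (U := U) (U' := U') (T := 1)
  rwa [mul_one, one_mul] at h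

theorem trace_starProjection [FiniteDimensional 𝕜 E] (U : Submodule 𝕜 E) :
    LinearMap.trace 𝕜 E U.starProjection.toLinearMap = Module.finrank 𝕜 U :=
  LinearMap.IsProj.trace
    ⟨U.starProjection_apply_mem, fun _ => Submodule.starProjection_eq_self_iff.mpr⟩

end Projections

theorem continuous_mk :
    Continuous fun v : {v : C2 // v ≠ 0} => (Projectivization.mk ℂ v.1 v.2 : CP1) :=
  continuous_quotient_mk' (s := projectivizationSetoid ℂ C2)

instance : CompactSpace CP1 := by
  let f (v : Metric.sphere (0 : C2) 1) : CP1 :=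
    Projectivization.mk ℂ v.1 (ne_zero_of_mem_unit_sphere v)
  have hf : Continuous f := continuous_mk.comp <|
    continuous_subtype_val.subtype_mk ne_zero_of_mem_unit_sphere
  refine Function.Surjective.compactSpace hf fun L => ?_
  have hunit : ‖(‖L.rep‖⁻¹ : ℂ) • L.rep‖ = 1 := norm_smul_inv_norm L.rep_nonzero
  refine ⟨⟨_, mem_sphere_zero_iff_norm.mpr hunit⟩, ?_⟩
  conv_rhs => rw [← L.mk_rep]
  exact (Projectivization.mk_eq_mk_iff' ℂ _ _ _ _).mpr ⟨_, rfl⟩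

theorem continuous_starProjection_submodule :
    Continuous fun L : CP1 => L.submodule.starProjection := by
  refine (isQuotientMap_quotient_mk' (s := projectivizationSetoid ℂ C2)).continuous_iff.mpr ?_
  refine continuous_clm_apply.mpr fun w => ?_
  change Continuous fun v : {v : C2 // v ≠ 0} =>
    (Projectivization.mk ℂ v.1 v.2).submodule.starProjection w
  simp only [Projectivization.submodule_mk, Submodule.starProjection_singleton]
  have hinner : Continuous fun v : {v : C2 // v ≠ 0} => inner ℂ v.1 w := by fun_prop
  have hnorm : Continuous fun v : {v : C2 // v ≠ 0} => ((‖v.1‖ ^ 2 : ℝ) : ℂ) := by fun_prop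
  exact (hinner.div hnorm fun v => by simpa using v.2).smul continuous_subtype_val

theorem isClosedEmbedding_starProjection_submodule :
    Topology.IsClosedEmbedding fun L : CP1 => L.submodule.starProjection :=
  continuous_starProjection_submodule.isClosedEmbedding fun _ _ h =>
    Projectivization.submodule_injective (Submodule.starProjection_inj.mp h)

instance : T2Space CP1 := isClosedEmbedding_starProjection_submodule.isEmbedding.t2Space

theorem continuous_chi : Continuous chi := by
  refine isClosedEmbedding_starProjection_submodule.isInducing.continuous_iff.mpr ?_
  refine ((continuous_const (y := 1)).sub continuous_starProjection_submodule).congr fun L => ?_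
  simp only [Function.comp_apply, submodule_chi]
  exact (Submodule.starProjection_orthogonal' _).symm

instance (n : ℕ) : CompleteSpace (V n) := FiniteDimensional.complete ℂ (V n)

namespace FlagVariety

variable {n : ℕ}

/-- The orthogonal projections onto the terms of a flag, which define the topology of `X(n)`. -/
def proj (W : FlagVariety n) (i : Fin (2 * n + 1)) : V n →L[ℂ] V n := (W.subspace i).starProjection

theorem isInducing_proj : Topology.IsInducing (proj : FlagVariety n → _) := ⟨rfl⟩

theorem continuous_proj_apply (i : Fin (2 * n + 1)) :
    Continuous fun W : FlagVariety n => W.proj i :=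
  (continuous_apply i).comp isInducing_proj.continuous

theorem inner_omega (W : FlagVariety n) (i : Fin (2 * n)) {a b : V n}
    (ha : a ∈ W.subspace i.succ ⊓ (W.subspace i.castSucc)ᗮ)
    (hb : b ∈ W.subspace i.succ ⊓ (W.subspace i.castSucc)ᗮ) :
    inner ℂ (omega n a) (omega n b) = inner ℂ a b := by
  have hgap : (W.subspace i.succ ⊓ (W.subspace i.castSucc)ᗮ).map (embed n).toLinearMap ≤
      Tail.gap (W.tail i.castSucc) := by
    rw [map_embed_inf_orthogonal]
    exact inf_le_inf_right _ (W.tail_succ_le_preimage i)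
  rw [← total_embed, ← total_embed, ← (embed n).inner_map_map]
  exact Tail.inner_total_of_mem_gap (W.tail_le_preimage _) (hgap ⟨a, ha, rfl⟩) (hgap ⟨b, hb, rfl⟩)

theorem starProjection_submodule_line (W : FlagVariety n) (i : Fin (2 * n)) :
    (W.line i).submodule.starProjection =
      (omega n).toContinuousLinearMap ∘L (W.proj i.succ - W.proj i.castSucc) ∘L
        (omega n).toContinuousLinearMap.adjoint := by
  rw [proj, proj,
    ← starProjection_inf_orthogonal (W.subspace_strictMono i.castSucc_lt_succ).le,
    ← starProjection_map_of_inner_eq _ fun a ha b hb => W.inner_omega i ha hb]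
  exact Submodule.starProjection_inj.mpr (W.submodule_line i)

theorem continuous_line : Continuous (line : FlagVariety n → Fin (2 * n) → CP1) := by
  refine continuous_pi fun i =>
    isClosedEmbedding_starProjection_submodule.isInducing.continuous_iff.mpr ?_
  refine Continuous.congr ?_ fun W => (W.starProjection_submodule_line i).symm
  exact continuous_const.clm_comp
    (((continuous_proj_apply _).sub (continuous_proj_apply _)).clm_comp continuous_const)

end FlagVariety

/-- Multiplication by `t` as a continuous linear map. -/
def mulX (n : ℕ) : V n →L[ℂ] V n :=
  LinearMap.toContinuousLinearMap (Module.toModuleEnd ℂ (V n) (X : ℂ[X]))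

theorem mulX_apply {n : ℕ} (a : V n) : mulX n a = (X : ℂ[X]) • a := rfl

/-- The families of orthogonal projections belonging to flags, described by closed conditions. -/
def flagProjections (n : ℕ) : Set (Fin (2 * n + 1) → V n →L[ℂ] V n) :=
  {P | (∀ i, IsStarProjection (P i)) ∧ (∀ i, P i * mulX n * P i = mulX n * P i) ∧
    (∀ i : Fin (2 * n), P i.succ * P i.castSucc = P i.castSucc) ∧
    ∀ i, LinearMap.trace ℂ (V n) (P i).toLinearMap = (i : ℕ)}

theorem starProjection_mem_flagProjections_iff {n : ℕ}
    {U : Fin (2 * n + 1) → Submodule ℂ (V n)} :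
    (fun i => (U i).starProjection) ∈ flagProjections n ↔
      U ∈ Set.range (FlagVariety.subspace (n := n)) := by
  simp only [FlagVariety.mem_range_subspace_iff, flagProjections, Set.mem_ofPred_eq,
    isStarProjection_starProjection, implies_true, true_and, Fin.monotone_iff_le_succ,
    starProjection_mul_mul_starProjection_eq_iff, starProjection_mul_starProjection_eq_iff,
    trace_starProjection, Nat.cast_inj, mulX_apply]

theorem range_proj (n : ℕ) : Set.range (FlagVariety.proj (n := n)) = flagProjections n := by
  ext P
  constructor
  · rintro ⟨W, rfl⟩
    exact starProjection_mem_flagProjections_iff.mpr ⟨W, rfl⟩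
  · intro hP
    choose U _ hU using fun i => isStarProjection_iff_eq_starProjection.mp (hP.1 i)
    obtain rfl : P = fun i => (U i).starProjection := funext hU
    obtain ⟨W, rfl⟩ := starProjection_mem_flagProjections_iff.mp hP
    exact ⟨W, rfl⟩

theorem isClosed_flagProjections (n : ℕ) : IsClosed (flagProjections n) := by
  have hP (i) : Continuous fun P : Fin (2 * n + 1) → V n →L[ℂ] V n => P i := continuous_apply i
  have htrace : Continuous fun T : V n →L[ℂ] V n => LinearMap.trace ℂ (V n) T.toLinearMap :=
    (LinearMap.trace ℂ (V n) ∘ₗ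
      ContinuousLinearMap.coeLM ℂ).continuous_of_finiteDimensional
  simp only [flagProjections, isStarProjection_iff, IsIdempotentElem, isSelfAdjoint_iff,
    Set.ofPred_and, Set.ofPred_forall]
  refine .inter (isClosed_iInter fun i => .inter ?_ ?_) (.inter (isClosed_iInter fun i => ?_)
    (.inter (isClosed_iInter fun i => ?_) (isClosed_iInter fun i => ?_)))
  · exact isClosed_eq ((hP i).mul (hP i)) (hP i)
  · exact isClosed_eq (hP i).star (hP i)
  · exact isClosed_eq (((hP i).mul continuous_const).mul (hP i)) (continuous_const.mul (hP i))
  · exact isClosed_eq ((hP _).mul (hP _)) (hP _)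
  · exact isClosed_eq (htrace.comp (hP i)) continuous_const

theorem isCompact_flagProjections (n : ℕ) : IsCompact (flagProjections n) := by
  have : ProperSpace (V n →L[ℂ] V n) := FiniteDimensional.proper ℂ _
  refine (isCompact_closedBall 0 1).of_isClosed_subset (isClosed_flagProjections n) fun P hP => ?_
  rw [mem_closedBall_zero_iff, pi_norm_le_iff_of_nonneg zero_le_one]
  intro i
  obtain ⟨U, _, hU⟩ := isStarProjection_iff_eq_starProjection.mp (hP.1 i)
  exact hU ▸ U.starProjection_norm_le

instance (n : ℕ) : CompactSpace (FlagVariety n) := by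
  rw [← isCompact_univ_iff, FlagVariety.isInducing_proj.isCompact_iff, Set.image_univ, range_proj]
  exact isCompact_flagProjections n

/-- The homeomorphism `X(n) → X'(n)` which sends a flag to its word of lines. -/
def homeomorphXPrime (n : ℕ) : FlagVariety n ≃ₜ XPrime n :=
  Continuous.homeoOfEquivCompactToT2
    (f := Equiv.ofBijective (fun W => (⟨W.line, W.line_mem_XPrime⟩ : XPrime n))
      ⟨fun _ _ h => FlagVariety.line_injective (congrArg Subtype.val h), fun u =>
        (FlagVariety.exists_line_eq u.2).imp fun _ h => Subtype.ext h⟩)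
    (FlagVariety.continuous_line.subtype_mk _)

/-- The restriction `Y(C(n)) → X'(n)` of a labelling of the polygon to the edges `eᵢ`. -/
def restrictEdges {n : ℕ} (m : Y (polygon n)) : XPrime n :=
  ⟨fun i => m.1 (polygonEdge n i), mem_XPrime_of_mem_Y m.2⟩

theorem apply_symm_polygonEdge {n : ℕ} (m : Y (polygon n)) (i : Fin (2 * n)) :
    m.1 (polygonEdge n i).symm = chi ((restrictEdges m).1 i) :=
  Y_subset_Y1 _ m.2 _

theorem restrictEdges_bijective {n : ℕ} [NeZero n] :
    Function.Bijective (restrictEdges : Y (polygon n) → XPrime n) := by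
  refine ⟨fun m m' h => Subtype.ext (funext fun d => ?_), fun u => ?_⟩
  · obtain ⟨i, rfl | rfl⟩ := exists_eq_polygonEdge d
    · exact congrFun (congrArg Subtype.val h) i
    · rw [apply_symm_polygonEdge, apply_symm_polygonEdge, h]
  · obtain ⟨m, hm, hmu⟩ := exists_mem_Y u.2
    exact ⟨⟨m, hm⟩, Subtype.ext (funext hmu)⟩

/-- The homeomorphism `Y(C(n)) → X'(n)` given by restriction to the edges `eᵢ`. -/
def homeomorphY (n : ℕ) [NeZero n] : Y (polygon n) ≃ₜ XPrime n where
  toEquiv := Equiv.ofBijective restrictEdges restrictEdges_bijective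
  continuous_toFun := continuous_induced_rng.mpr <| continuous_pi fun i =>
    (continuous_apply (polygonEdge n i)).comp continuous_subtype_val
  continuous_invFun := by
    set e := Equiv.ofBijective restrictEdges (restrictEdges_bijective (n := n))
    have he (u) : restrictEdges (e.symm u) = u := e.apply_symm_apply u
    have hu (i) : Continuous fun u : XPrime n => u.1 i :=
      (continuous_apply i).comp continuous_subtype_val
    refine continuous_induced_rng.mpr (continuous_pi fun d => ?_)
    obtain ⟨i, rfl | rfl⟩ := exists_eq_polygonEdge d
    · exact (hu i).congr fun u => (congrFun (congrArg Subtype.val (he u)) i).symm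
    · refine (continuous_chi.comp (hu i)).congr fun u => ?_
      exact ((apply_symm_polygonEdge (e.symm u) i).trans (by rw [he]; rfl)).symm

end KhovanovSpringer

end

open KhovanovSpringer in
theorem mainTheorem3 (n : ℕ) :
    ∃ omegaBar : FlagVariety n → Fin (2 * n) → CP1,
      (∀ W i, (omegaBar W i).submodule = omegaLine W i) ∧
      (∃ h : FlagVariety n ≃ₜ XPrime n, ∀ W i, (h W : Fin (2 * n) → CP1) i = omegaBar W i) ∧
      (0 < n → ∃ σ : FlagVariety n ≃ₜ Y (polygon n), ∀ W i,
        (σ W : (polygon n).graph.Dart → CP1) (polygonEdge n i) = omegaBar W i ∧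
        (σ W : (polygon n).graph.Dart → CP1) (polygonEdge n i).symm = chi (omegaBar W i)) := by
  refine ⟨FlagVariety.line, FlagVariety.submodule_line,
    ⟨homeomorphXPrime n, fun W i => rfl⟩, fun hn => ?_⟩
  have : NeZero n := ⟨hn.ne'⟩
  let σ := (homeomorphXPrime n).trans (homeomorphY n).symm
  have hσ (W) : restrictEdges (σ W) = homeomorphXPrime n W := (homeomorphY n).apply_symm_apply _
  refine ⟨σ, fun W i => ⟨congrFun (congrArg Subtype.val (hσ W)) i, ?_⟩⟩
  rw [apply_symm_polygonEdge, hσ]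
  rfl
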